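/- Let $A>0$ and $V,\varphi_0,x_0\in\mathbb R$, and put $$q(x)=\frac{A\,e^{i(Vx+\varphi_0)}}{\cosh (A(x-x_0))},\qquad x\in\mathbb R .$$ This $q$ is a Schwartz function. For $c\in\mathbb C$ and a spectral parameter $k$, consider the linear problem $$\Psi_x=(-ik\sigma_3+W)\Psi,\qquad \sigma_3=\begin{pmatrix}1&0\\0&-1\end{pmatrix},\qquad W(x)=c\begin{pmatrix}0&q(x)\\ q^*(x)&0\end{pmatrix}.$$ For $k\in\mathbb R$ let $\Psi^\pm$ be the Jost solutions, $\lim_{x\to\pm\infty}e^{ik\sigma_3x}\Psi^\pm(x,k)=1$, and let $S(k)$ be the scattering matrix, $\Psi^+=\Psi^-S(k)$; the scattering data of $q$ with coupling $c$ are $a(k,c)=S_{22}(k)$ and $b(k,c)=S_{12}(k)$. For $\operatorname{Im}k\ge 0$ put $a(k,c)=\det(\psi^-,\psi^+)$, where $\psi^\pm$ are the solutions with $e^{ikx}\psi^-\to(1,0)^T$ as $x\to-\infty$ and $e^{-ikx}\psi^+\to(0,1)^T$ as $x\to+\infty$. Write $\mathcal F_c$ for the map that sends a Schwartz function to its scattering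 data $(a(\cdot,c),b(\cdot,c))$ on $\mathbb R$. (1) For every $c\in\mathbb C$ and $k\in\mathbb R$ the scattering data of $q$ exist, are unique, and are $$a(k,c)=\frac{\Gamma\left(\frac12-\frac iA(k+\frac V2)\right)^2}{\Gamma\left(\frac12-ic-\frac iA(k+\frac V2)\right)\Gamma\left(\frac12+ic-\frac iA(k+\frac V2)\right)},\qquad b(k,c)=-\frac{\sin(i\pi c)}{i}\,\frac{e^{i(\varphi_0+(2k+V)x_0)}}{\cosh\left(\frac{\pi}{A}(k+\frac V2)\right)},$$ where $1/\Gamma$ is read as $0$ at the poles of $\Gamma$. The formula for $a(k,c)$ holds for all complex $k$ with $\operatorname{Im}k\ge0$. (2) Let $k_1=-\frac V2+\frac{iA}2$. For $c=i$ the scattering data are the one-soliton data $\left(\frac{k-k_1}{k-k_1^*},0\right)$. For every $c\in\mathbb C$ the quench correspondence $\mathcal Q_{c,i}=\mathcal F_c\circ\mathcal F_i^{-1}$ (the set of all pairs $(\mathcal F_i[p],\mathcal F_c[p])$ with $p$ a Schwartz function) relates $$\left(\frac{k-k_1}{k-k_1^*},0\right)\quad\text{to}\quad\left(\frac{\Gamma\left(1-\frac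 iA(k-k_1)\right)^2}{\Gamma\left(1-ic-\frac iA(k-k_1)\right)\Gamma\left(1+ic-\frac iA(k-k_1)\right)},\ \frac{\sin(i\pi c)}{i}\,\frac{i\,e^{i(\varphi_0+(2k+V)x_0)}}{\sinh\left(\frac\pi A(k-k_1)\right)}\right).$$ (3) For $c=in$ with $n\in\mathbb N$, the data are reflectionless, $b(k,in)=0$ for all $k\in\mathbb R$, and for $\operatorname{Im}k\ge0$ $$a(k,in)=\prod_{j=1}^n\frac{k-k_j}{k-k_j^*},\qquad k_j=-\frac V2+\frac{(2j-1)iA}{2}.$$ The zeros of $a(\cdot,in)$ in the closed upper half-plane are exactly $k_1,\dots,k_n$, and these are $n$ distinct points. -/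

import Mathlib

open Complex Filter Topology SchwartzMap
open scoped ComplexConjugate

noncomputable section

namespace NLSQuench

/-- The rapidly decreasing initial datum
`q(x,0) = A e^{i (V x + φ₀)} / cosh (A (x - x₀))`. -/
def soliton (A V φ₀ x₀ : ℝ) (x : ℝ) : ℂ :=
  (A : ℂ) * Complex.exp (I * ((V : ℂ) * x + φ₀)) / Complex.cosh ((A : ℂ) * (x - x₀))

/-- The matrix potential `W = c [[0, q], [q*, 0]]` of the auxiliary problem. -/
def potential (c : ℂ) (q : ℝ → ℂ) (x : ℝ) : Matrix (Fin 2) (Fin 2) ℂ :=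
  c • !![0, q x; conj (q x), 0]

/-- The Pauli matrix `σ₃`. -/
def sigma3 : Matrix (Fin 2) (Fin 2) ℂ := !![1, 0; 0, -1]

/-- `ψ : ℝ → ℂ²` solves the spatial auxiliary problem `ψ_x = (- i k σ₃ + W) ψ`. -/
def IsSolution (c : ℂ) (q : ℝ → ℂ) (k : ℂ) (ψ : ℝ → Fin 2 → ℂ) : Prop :=
  ∀ x : ℝ, HasDerivAt ψ
    ((-(I * k) • sigma3 + potential c q x).mulVec (ψ x)) x

/-- The free solution `E(x,k) = e^{- i k σ₃ x}` (rapidly decreasing class: `W → 0` at `± ∞`). -/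
def freeSolution (k : ℂ) (x : ℝ) : Matrix (Fin 2) (Fin 2) ℂ :=
  !![Complex.exp (-(I * k * x)), 0; 0, Complex.exp (I * k * x)]

/-- `Ψ` is the (matrix) Jost solution at `+ ∞` (`l = atTop`) or at `- ∞` (`l = atBot`):
every column solves the auxiliary problem and `E⁻¹ Ψ → 1` along `l`. -/
def IsJost (c : ℂ) (q : ℝ → ℂ) (k : ℂ) (l : Filter ℝ)
    (Ψ : ℝ → Matrix (Fin 2) (Fin 2) ℂ) : Prop :=
  (∀ j : Fin 2, IsSolution c q k fun x i => Ψ x i j) ∧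
    Tendsto (fun x => (freeSolution k x)⁻¹ * Ψ x) l (𝓝 1)

/-- `S` is the scattering matrix at the real spectral parameter `k`: `Ψ⁺ = Ψ⁻ S`. -/
def IsScatteringMatrix (c : ℂ) (q : ℝ → ℂ) (k : ℝ) (S : Matrix (Fin 2) (Fin 2) ℂ) : Prop :=
  ∃ Ψp Ψm : ℝ → Matrix (Fin 2) (Fin 2) ℂ,
    IsJost c q k atTop Ψp ∧ IsJost c q k atBot Ψm ∧ ∀ x, Ψp x = Ψm x * S

/-- The pair of functions `D = (a, b)` of the real spectral parameter is the scattering data of `q`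
with coupling `c`: `a = S₂₂` and `b = S₁₂`. -/
def IsScatteringData (c : ℂ) (q : ℝ → ℂ) (D : ℝ → ℂ × ℂ) : Prop :=
  ∀ k : ℝ, ∃ S : Matrix (Fin 2) (Fin 2) ℂ, IsScatteringMatrix c q k S ∧ D k = (S 1 1, S 0 1)

/-- The coefficient `a` at a point of the closed upper half-plane: `a = det (ψ⁻, ψ⁺)`, where
`ψ⁻ ~ e^{- i k x} (1, 0)` at `- ∞` is the first column of the Jost solution at `- ∞` and
`ψ⁺ ~ e^{i k x} (0, 1)` at `+ ∞` is the second column of the Jost solution at `+ ∞`. -/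
def IsUpperCoefficient (c : ℂ) (q : ℝ → ℂ) (k a : ℂ) : Prop :=
  ∃ ψm ψp : ℝ → Fin 2 → ℂ, IsSolution c q k ψm ∧ IsSolution c q k ψp ∧
    Tendsto (fun x : ℝ => Complex.exp (I * k * x) • ψm x) atBot (𝓝 ![1, 0]) ∧
    Tendsto (fun x : ℝ => Complex.exp (-(I * k * x)) • ψp x) atTop (𝓝 ![0, 1]) ∧
    ∀ x : ℝ, Matrix.det !![ψm x 0, ψp x 0; ψm x 1, ψp x 1] = a

/-- The graph of the quench map `Q_{c',c} = F_{c'} ∘ F_c⁻¹`, where `F_c` sends a Schwartz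
function to its scattering data with coupling `c`: `D` and `D'` are the scattering data of one and
the same field with couplings `c` and `c'`. -/
def QuenchMap (c' c : ℂ) (D D' : ℝ → ℂ × ℂ) : Prop :=
  ∃ q : 𝓢(ℝ, ℂ), IsScatteringData c q D ∧ IsScatteringData c' q D'

end NLSQuench

end

namespace NLSQuench

noncomputable section

/-! Writing a solution as `e^{-ikx} (U, e^{-i(Vx+φ₀)} R)` with `y = A (x - x₀)` removes the phase of
the soliton and leaves the system `U' = c sech y · R`, `R' = 2iκ R + c sech y · U`, where `κ = (k +
V/2)/A`. In the variable `s = (1 + tanh y)/2`, for which `sech² y = 4s(1-s)`, this system is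
hypergeometric. With `d = 1/2 - iκ`, the solution normalised at `s = 0` is `U = ₂F₁(ic, -ic; d; s)`,
with `R` essentially its derivative. The coefficient `a` is the value of `U` at `s = 1`, and Gauss's
theorem `tsum_hyperCoeff` turns it into the Gamma quotient (`exists_isAmplitude`). Gauss's condition
here is `Re d > 0`, which `Im κ ≥ 0` guarantees.

For real `κ` the Euler-transformed series, with parameters `d ∓ ic`, displays the limit of
`e^{-2iκy} R` at `s = 1`. Gauss's theorem and the reflection formula for Gamma then give `b`
(`exists_isAmplitude_of_im_eq_zero`).

The symmetry `(y, κ) ↦ (-y, -κ)` supplies the Jost solutions at the other end. The entries `S₂₂` and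
`S₁₂` are Wronskians, which are constant in `x` and so can be read off from limits at `+∞`;
`IsSolution.wronskian_congr` makes them independent of the chosen Jost solutions. At `c = in` the
sine in `b` vanishes and the functional equation of Gamma collapses `a` to a finite product. -/

/-! ### Hypergeometric coefficients and Gauss's summation theorem -/

/-- The Taylor coefficients of the Gauss hypergeometric function `₂F₁(a, b; d; ·)` at `0`. -/
def hyperCoeff (a b d : ℂ) (n : ℕ) : ℂ :=
  ∏ j ∈ Finset.range n, ((a + j) * (b + j) / ((d + j) * (1 + j)))

@[simp] lemma hyperCoeff_zero (a b d : ℂ) : hyperCoeff a b d 0 = 1 := by simp [hyperCoeff]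

lemma hyperCoeff_succ (a b d : ℂ) (n : ℕ) :
    hyperCoeff a b d (n + 1) =
      hyperCoeff a b d n * ((a + n) * (b + n) / ((d + n) * (1 + n))) :=
  Finset.prod_range_succ _ _

lemma add_natCast_ne_zero {d : ℂ} (hd : 0 < d.re) (n : ℕ) : d + n ≠ 0 := by
  intro h
  have := congrArg Complex.re h
  simp at this
  have : (0 : ℝ) ≤ n := n.cast_nonneg
  linarith

lemma one_add_natCast_ne_zero (n : ℕ) : (1 : ℂ) + n ≠ 0 :=
  add_natCast_ne_zero (by simp) n

/-- `1 / Γ` as the limit of `1 / GammaSeq`, at every point. -/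
lemma tendsto_inv_GammaSeq (s : ℂ) :
    Tendsto (fun n => (GammaSeq s n)⁻¹) atTop (𝓝 (Gamma s)⁻¹) := by
  by_cases h : Gamma s = 0
  · obtain ⟨m, rfl⟩ := (Gamma_eq_zero_iff s).1 h
    rw [h, inv_zero]
    refine tendsto_const_nhds.congr' ?_
    filter_upwards [eventually_ge_atTop m] with n hn
    have : ∏ j ∈ Finset.range (n + 1), (-(m : ℂ) + j) = 0 :=
      Finset.prod_eq_zero (Finset.mem_range.2 (Nat.lt_succ_of_le hn)) (by simp)
    simp [GammaSeq, this]
  · exact (GammaSeq_tendsto_Gamma s).inv₀ h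

/-- Valid even where the product vanishes: there `GammaSeq` is a division by zero, hence `0`, and so
is its inverse. -/
lemma prod_add_eq_inv_GammaSeq (s : ℂ) {n : ℕ} (hn : n ≠ 0) :
    ∏ j ∈ Finset.range (n + 1), (s + j) = (n : ℂ) ^ s * n.factorial * (GammaSeq s n)⁻¹ := by
  have h : (n : ℂ) ^ s * n.factorial ≠ 0 :=
    mul_ne_zero (by simp [cpow_eq_zero_iff, hn]) (by exact_mod_cast n.factorial_ne_zero)
  rw [GammaSeq, inv_div, mul_div_cancel₀ _ h]

/-- The balance `d + e = a + b` cancels the powers of `n`, so the partial products converge to a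
pure Gamma quotient. -/
lemma prod_ratio_eq_GammaSeq (a b d e : ℂ) (h : d + e = a + b) {n : ℕ} (hn : n ≠ 0) :
    ∏ j ∈ Finset.range (n + 1), ((a + j) * (b + j) / ((d + j) * (e + j))) =
      (GammaSeq a n)⁻¹ * (GammaSeq b n)⁻¹ * (GammaSeq d n * GammaSeq e n) := by
  have hn' : (n : ℂ) ≠ 0 := by exact_mod_cast hn
  have hf : (n.factorial : ℂ) ≠ 0 := by exact_mod_cast n.factorial_ne_zero
  have h1 : ∀ z : ℂ, (n : ℂ) ^ z ≠ 0 := fun z => by simp [cpow_eq_zero_iff, hn]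
  have h2 : (n : ℂ) ^ a * (n : ℂ) ^ b = (n : ℂ) ^ d * (n : ℂ) ^ e := by
    rw [← cpow_add _ _ hn', ← cpow_add _ _ hn', h]
  rw [Finset.prod_div_distrib, Finset.prod_mul_distrib, Finset.prod_mul_distrib,
    prod_add_eq_inv_GammaSeq a hn, prod_add_eq_inv_GammaSeq b hn, prod_add_eq_inv_GammaSeq d hn,
    prod_add_eq_inv_GammaSeq e hn]
  have h3 : (n : ℂ) ^ a * n.factorial * (GammaSeq a n)⁻¹ *
      ((n : ℂ) ^ b * n.factorial * (GammaSeq b n)⁻¹) =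
      ((n : ℂ) ^ d * n.factorial * ((n : ℂ) ^ e * n.factorial)) *
        ((GammaSeq a n)⁻¹ * (GammaSeq b n)⁻¹) := by
    linear_combination (n.factorial ^ 2 * (GammaSeq a n)⁻¹ * (GammaSeq b n)⁻¹ : ℂ) * h2
  have h4 : (n : ℂ) ^ d * n.factorial * (GammaSeq d n)⁻¹ *
      ((n : ℂ) ^ e * n.factorial * (GammaSeq e n)⁻¹) =
      ((n : ℂ) ^ d * n.factorial * ((n : ℂ) ^ e * n.factorial)) *
        (GammaSeq d n * GammaSeq e n)⁻¹ := by
    rw [mul_inv]; ring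
  rw [h3, h4, mul_div_mul_left _ _ (mul_ne_zero (mul_ne_zero (h1 d) hf) (mul_ne_zero (h1 e) hf)),
    div_inv_eq_mul]

/-- Growth of the hypergeometric coefficients. -/
lemma exists_norm_hyperCoeff_le (a b d : ℂ) :
    ∃ K : ℝ, ∀ n : ℕ, n ≠ 0 →
      ‖hyperCoeff a b d (n + 1)‖ ≤ K * (n : ℝ) ^ (a.re + b.re - d.re - 1) := by
  -- After the factorials cancel, the coefficient is `n^(a+b-d-1)` times this convergent, hence
  -- bounded, factor.
  have hlim : Tendsto (fun n => (GammaSeq a n)⁻¹ * (GammaSeq b n)⁻¹ *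
      (GammaSeq d n * GammaSeq 1 n)) atTop
      (𝓝 ((Gamma a)⁻¹ * (Gamma b)⁻¹ * (Gamma d * Gamma 1))) :=
    ((tendsto_inv_GammaSeq a).mul (tendsto_inv_GammaSeq b)).mul
      ((GammaSeq_tendsto_Gamma d).mul (GammaSeq_tendsto_Gamma 1))
  obtain ⟨K, hK⟩ := hlim.norm.bddAbove_range
  refine ⟨K, fun n hn => ?_⟩
  have hn' : (n : ℂ) ≠ 0 := by exact_mod_cast hn
  have hf : (n.factorial : ℂ) ≠ 0 := by exact_mod_cast n.factorial_ne_zero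
  have h1 : ∀ z : ℂ, (n : ℂ) ^ z ≠ 0 := fun z => by simp [cpow_eq_zero_iff, hn]
  have key : hyperCoeff a b d (n + 1) = (GammaSeq a n)⁻¹ * (GammaSeq b n)⁻¹ *
      (GammaSeq d n * GammaSeq 1 n) * (n : ℂ) ^ (a + b - d - 1) := by
    rw [hyperCoeff, Finset.prod_div_distrib, Finset.prod_mul_distrib, Finset.prod_mul_distrib,
      prod_add_eq_inv_GammaSeq a hn, prod_add_eq_inv_GammaSeq b hn, prod_add_eq_inv_GammaSeq d hn,
      prod_add_eq_inv_GammaSeq 1 hn, cpow_sub _ _ hn', cpow_sub _ _ hn', cpow_add _ _ hn']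
    have := h1 d
    have := h1 1
    simp only [div_eq_mul_inv, mul_inv, inv_inv]
    field_simp
  rw [key, norm_mul]
  have h2 : ‖(n : ℂ) ^ (a + b - d - 1)‖ = (n : ℝ) ^ (a.re + b.re - d.re - 1) := by
    have := norm_cpow_eq_rpow_re_of_pos (x := (n : ℝ)) (by positivity) (a + b - d - 1)
    simpa using this
  rw [h2]
  exact mul_le_mul_of_nonneg_right (hK ⟨n, rfl⟩) (by positivity)

lemma summable_hyperCoeff {a b d : ℂ} (h : a.re + b.re < d.re) :
    Summable fun n => ‖hyperCoeff a b d n‖ := by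
  obtain ⟨K, hK⟩ := exists_norm_hyperCoeff_le a b d
  rw [← summable_nat_add_iff 2]
  have hs : Summable fun n : ℕ => K * ((n + 1 : ℕ) : ℝ) ^ (a.re + b.re - d.re - 1) :=
    ((summable_nat_add_iff 1).2 (Real.summable_nat_rpow.2 (by linarith))).mul_left K
  exact hs.of_nonneg_of_le (fun n => norm_nonneg _) fun n => hK (n + 1) n.succ_ne_zero

/-- This is the boundary term of the telescoping sum in the contiguous relation; it decays like
`n^(a+b-d)`. -/
lemma tendsto_natCast_mul_hyperCoeff {a b d : ℂ} (h : a.re + b.re < d.re) :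
    Tendsto (fun n : ℕ => (n : ℂ) * hyperCoeff a b d n) atTop (𝓝 0) := by
  obtain ⟨K, hK⟩ := exists_norm_hyperCoeff_le a b d
  rw [← tendsto_add_atTop_iff_nat 1]
  have h1 : Tendsto (fun n : ℕ => K * ((n : ℝ) ^ (-(d.re - a.re - b.re)) +
      (n : ℝ) ^ (-(d.re - a.re - b.re + 1)))) atTop (𝓝 0) := by
    have h2 := (tendsto_rpow_neg_atTop (y := d.re - a.re - b.re) (by linarith)).comp
      tendsto_natCast_atTop_atTop
    have h3 := (tendsto_rpow_neg_atTop (y := d.re - a.re - b.re + 1) (by linarith)).comp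
      tendsto_natCast_atTop_atTop
    simpa using (h2.add h3).const_mul K
  refine squeeze_zero_norm' ?_ h1
  filter_upwards [eventually_ne_atTop 0] with n hn
  have hn' : (0 : ℝ) < n := by positivity
  have h4 : (n : ℝ) ^ (-(d.re - a.re - b.re)) = n * (n : ℝ) ^ (a.re + b.re - d.re - 1) := by
    rw [Real.rpow_sub_one hn'.ne']; field_simp; congr 1; ring
  have h5 : -(d.re - a.re - b.re + 1) = a.re + b.re - d.re - 1 := by ring
  have h6 : ‖((n + 1 : ℕ) : ℂ)‖ = (n : ℝ) + 1 := by rw [norm_natCast]; push_cast; ring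
  rw [norm_mul, h4, h5, h6]
  nlinarith [hK n hn]

lemma hyperCoeff_div_add {a b d : ℂ} (hd : 0 < d.re) (n : ℕ) :
    hyperCoeff a b (d + 1) n * (d + n) = d * hyperCoeff a b d n := by
  induction n with
  | zero => simp
  | succ n ih =>
    have h1 := add_natCast_ne_zero hd n
    have h2 := add_natCast_ne_zero (d := d + 1) (by simp; linarith) n
    have h3 := one_add_natCast_ne_zero n
    rw [hyperCoeff_succ, hyperCoeff_succ, ← mul_assoc, ← ih]
    have h4 : d + ((n + 1 : ℕ) : ℂ) = d + 1 + n := by push_cast; ring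
    rw [h4]
    field_simp

/-- The contiguous relation behind Gauss's theorem. -/
lemma tsum_hyperCoeff_contiguous {a b d : ℂ} (hd : 0 < d.re) (h : a.re + b.re < d.re) :
    (d - a - b) * ∑' n, hyperCoeff a b d n =
      (d - a) * (d - b) / d * ∑' n, hyperCoeff a b (d + 1) n := by
  have hd0 : d ≠ 0 := by simpa using add_natCast_ne_zero hd 0
  have hs := (summable_hyperCoeff h).of_norm
  have hs' := (summable_hyperCoeff (a := a) (b := b) (d := d + 1) (by simp; linarith)).of_norm
  -- The difference of the two series telescopes termwise, with primitive `n ↦ n * hyperCoeff a b d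
  -- n`.
  have hterm : ∀ n : ℕ, (d - a - b) * hyperCoeff a b d n -
      (d - a) * (d - b) / d * hyperCoeff a b (d + 1) n =
      (n : ℂ) * hyperCoeff a b d n - ((n + 1 : ℕ) : ℂ) * hyperCoeff a b d (n + 1) := by
    intro n
    have h1 := add_natCast_ne_zero hd n
    have h3 := one_add_natCast_ne_zero n
    have h4 : hyperCoeff a b (d + 1) n = d * hyperCoeff a b d n / (d + n) := by
      rw [eq_div_iff h1, hyperCoeff_div_add hd]
    rw [h4, hyperCoeff_succ]
    push_cast
    field_simp
    ring
  have hsum := (hs.mul_left (d - a - b)).sub (hs'.mul_left ((d - a) * (d - b) / d))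
  have h1 := hsum.hasSum.tendsto_sum_nat
  have h2 : Tendsto (fun N => ∑ n ∈ Finset.range N, ((d - a - b) * hyperCoeff a b d n -
      (d - a) * (d - b) / d * hyperCoeff a b (d + 1) n)) atTop (𝓝 0) := by
    simp_rw [hterm]
    have : ∀ N : ℕ, ∑ n ∈ Finset.range N, ((n : ℂ) * hyperCoeff a b d n -
        ((n + 1 : ℕ) : ℂ) * hyperCoeff a b d (n + 1)) = -((N : ℂ) * hyperCoeff a b d N) := by
      intro N
      rw [Finset.sum_range_sub' (fun n : ℕ => (n : ℂ) * hyperCoeff a b d n)]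
      simp
    simp_rw [this]
    simpa using (tendsto_natCast_mul_hyperCoeff h).neg
  have h3 := tendsto_nhds_unique h1 h2
  rw [(hs.mul_left _).tsum_sub (hs'.mul_left _), tsum_mul_left, tsum_mul_left] at h3
  exact sub_eq_zero.1 h3

/-- Dominated convergence: each term with `n ≥ 1` carries a denominator growing with `N`, so only
the constant term survives. The dominating series has parameters `‖a‖, ‖b‖; Re d + M`, where `M >
‖a‖ + ‖b‖` makes it summable. -/
lemma tendsto_tsum_hyperCoeff_add {a b d : ℂ} (hd : 0 < d.re) :
    Tendsto (fun N : ℕ => ∑' n, hyperCoeff a b (d + N) n) atTop (𝓝 1) := by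
  obtain ⟨M, hM⟩ := exists_nat_gt (‖a‖ + ‖b‖)
  set α : ℂ := ((‖a‖ : ℝ) : ℂ)
  set β : ℂ := ((‖b‖ : ℝ) : ℂ)
  set δ : ℂ := ((d.re + M : ℝ) : ℂ)
  have hδ : ∀ j : ℕ, ‖δ + j‖ = d.re + M + j := fun j => by
    have : δ + j = ((d.re + M + j : ℝ) : ℂ) := by simp [δ]
    rw [this, norm_real, Real.norm_of_nonneg (by positivity)]
  have hb : ∀ᶠ N : ℕ in atTop, ∀ n, ‖hyperCoeff a b (d + N) n‖ ≤ ‖hyperCoeff α β δ n‖ := by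
    filter_upwards [eventually_ge_atTop M] with N hN n
    rw [hyperCoeff, hyperCoeff, norm_prod, norm_prod]
    refine Finset.prod_le_prod (fun _ _ => norm_nonneg _) fun j _ => ?_
    have hα : ∀ z : ℂ, ‖z + j‖ ≤ ‖((‖z‖ : ℝ) : ℂ) + j‖ := fun z => by
      have : ((‖z‖ : ℝ) : ℂ) + j = ((‖z‖ + j : ℝ) : ℂ) := by simp
      rw [this, norm_real, Real.norm_of_nonneg (by positivity)]
      simpa using norm_add_le z (j : ℂ)
    have hd' : ‖δ + j‖ ≤ ‖d + N + j‖ := by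
      rw [hδ]
      refine le_trans ?_ (re_le_norm _)
      have : (M : ℝ) ≤ N := by exact_mod_cast hN
      simp; linarith
    have hpos : 0 < ‖δ + j‖ := by rw [hδ]; positivity
    have hone : 0 < ‖(1 : ℂ) + j‖ := norm_pos_iff.2 (one_add_natCast_ne_zero j)
    rw [norm_div, norm_div, norm_mul, norm_mul, norm_mul, norm_mul]
    gcongr
    · exact hα a
    · exact hα b
  have hs : Summable fun n => ‖hyperCoeff α β δ n‖ :=
    summable_hyperCoeff (by simp [α, β, δ]; linarith)
  have hlim : ∀ n, Tendsto (fun N : ℕ => hyperCoeff a b (d + N) n) atTop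
      (𝓝 (if n = 0 then 1 else 0)) := by
    intro n
    induction n with
    | zero => simp
    | succ n ih =>
      have hz : Tendsto (fun N : ℕ => (a + n) * (b + n) / ((d + N + n) * (1 + n))) atTop (𝓝 0) := by
        have h1 : Tendsto (fun N : ℕ => ‖d + N + n‖) atTop atTop := by
          refine tendsto_atTop_mono (fun N => ?_) tendsto_natCast_atTop_atTop
          refine le_trans ?_ (re_le_norm _)
          have := n.cast_nonneg (α := ℝ)
          simp; linarith
        have h2 := (tendsto_inv₀_cobounded.comp (tendsto_norm_atTop_iff_cobounded.1 h1)).const_mul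
          ((a + n) * (b + n) / (1 + n))
        rw [mul_zero] at h2
        refine h2.congr fun N => ?_
        simp only [Function.comp]
        rw [div_mul_eq_div_div_swap, div_eq_mul_inv _ (d + N + n)]
      simpa [hyperCoeff_succ] using ih.mul hz
  have := tendsto_tsum_of_dominated_convergence hs hlim hb
  simpa using this

/-- Gauss's summation theorem. -/
theorem tsum_hyperCoeff {a b d : ℂ} (hd : 0 < d.re) (h : a.re + b.re < d.re) :
    ∑' n, hyperCoeff a b d n =
      Gamma d * Gamma (d - a - b) / (Gamma (d - a) * Gamma (d - b)) := by
  -- Iterating the contiguous relation pushes `d` to `d + N`, where the series tends to `1`; the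
  -- accumulated product tends to the Gamma quotient.
  have hiter : ∀ N : ℕ, ∑' n, hyperCoeff a b d n =
      (∏ j ∈ Finset.range N, ((d - a + j) * (d - b + j) / ((d + j) * (d - a - b + j)))) *
        ∑' n, hyperCoeff a b (d + N) n := by
    intro N
    induction N with
    | zero => simp
    | succ N ih =>
      have h1 : d + N ≠ 0 := add_natCast_ne_zero hd N
      have h2 : d - a - b + N ≠ 0 := add_natCast_ne_zero (by simp; linarith) N
      have hN : (0 : ℝ) ≤ N := N.cast_nonneg
      have hc := tsum_hyperCoeff_contiguous (a := a) (b := b) (d := d + N) (by simp; linarith)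
        (by simp; linarith)
      rw [ih, Finset.prod_range_succ, mul_assoc]
      congr 1
      have h3 : d + ((N + 1 : ℕ) : ℂ) = d + N + 1 := by push_cast; ring
      rw [h3]
      have h4 : d + N - a - b = d - a - b + N := by ring
      rw [h4] at hc
      rw [← mul_right_inj' h2, hc]
      field_simp
      ring
  have hP : Tendsto (fun N : ℕ => (GammaSeq (d - a) N)⁻¹ * (GammaSeq (d - b) N)⁻¹ *
      (GammaSeq d N * GammaSeq (d - a - b) N) * ∑' n, hyperCoeff a b (d + (N + 1 : ℕ)) n) atTop
      (𝓝 ((Gamma (d - a))⁻¹ * (Gamma (d - b))⁻¹ * (Gamma d * Gamma (d - a - b)) * 1)) :=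
    (((tendsto_inv_GammaSeq _).mul (tendsto_inv_GammaSeq _)).mul
      ((GammaSeq_tendsto_Gamma d).mul (GammaSeq_tendsto_Gamma _))).mul
      ((tendsto_tsum_hyperCoeff_add hd).comp (tendsto_add_atTop_nat 1))
  have hC : Tendsto (fun _ : ℕ => ∑' n, hyperCoeff a b d n) atTop
      (𝓝 ((Gamma (d - a))⁻¹ * (Gamma (d - b))⁻¹ * (Gamma d * Gamma (d - a - b)) * 1)) := by
    refine hP.congr' ?_
    filter_upwards [eventually_ne_atTop 0] with N hN
    rw [hiter (N + 1), prod_ratio_eq_GammaSeq _ _ _ _ (by ring) hN]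
  rw [tendsto_nhds_unique tendsto_const_nhds hC, mul_one, div_eq_mul_inv, mul_inv]
  ring

/-! ### Power series with polynomially bounded coefficients -/

/-- Polynomial growth of a sequence of coefficients. -/
def PolyBounded (f : ℕ → ℂ) : Prop :=
  ∃ (K : ℝ) (p : ℕ), ∀ n : ℕ, ‖f n‖ ≤ K * ((n : ℝ) + 1) ^ p

lemma PolyBounded.const_mul {f : ℕ → ℂ} (hf : PolyBounded f) (z : ℂ) :
    PolyBounded fun n => z * f n := by
  obtain ⟨K, p, h⟩ := hf
  refine ⟨‖z‖ * K, p, fun n => ?_⟩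
  rw [norm_mul, mul_assoc]
  exact mul_le_mul_of_nonneg_left (h n) (norm_nonneg _)

lemma PolyBounded.natCast_mul {f : ℕ → ℂ} (hf : PolyBounded f) :
    PolyBounded fun n => (n : ℂ) * f n := by
  obtain ⟨K, p, h⟩ := hf
  refine ⟨K, p + 1, fun n => ?_⟩
  have h0 := (norm_nonneg _).trans (h n)
  rw [norm_mul, norm_natCast, pow_succ, ← mul_assoc, mul_comm]
  exact mul_le_mul (h n) (by linarith) (by positivity) h0

lemma PolyBounded.succ {f : ℕ → ℂ} (hf : PolyBounded f) : PolyBounded fun n => f (n + 1) := by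
  obtain ⟨K, p, h⟩ := hf
  have hK : 0 ≤ K := by simpa using (norm_nonneg _).trans (h 0)
  refine ⟨K * 2 ^ p, p, fun n => (h (n + 1)).trans ?_⟩
  rw [mul_assoc, ← mul_pow]
  push_cast
  gcongr
  linarith [n.cast_nonneg (α := ℝ)]

lemma PolyBounded.deriv {f : ℕ → ℂ} (hf : PolyBounded f) :
    PolyBounded fun n => ((n + 1 : ℕ) : ℂ) * f (n + 1) :=
  hf.natCast_mul.succ

lemma PolyBounded.summable_norm {f : ℕ → ℂ} (hf : PolyBounded f) {r : ℝ} (h0 : 0 ≤ r)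
    (h1 : r < 1) : Summable fun n => ‖f n‖ * r ^ n := by
  obtain ⟨K, p, h⟩ := hf.succ
  have hs : Summable fun n : ℕ => (n : ℝ) ^ p * r ^ n :=
    summable_pow_mul_geometric_of_norm_lt_one p (by rwa [Real.norm_of_nonneg h0])
  rw [← summable_nat_add_iff 1]
  refine (((summable_nat_add_iff 1).2 hs).mul_left K).of_nonneg_of_le
    (fun n => by positivity) fun n => ?_
  rw [← mul_assoc]
  push_cast
  exact mul_le_mul_of_nonneg_right (h n) (by positivity)

/-- The sum of a power series. -/
def powerSum (f : ℕ → ℂ) (z : ℂ) : ℂ := ∑' n, f n * z ^ n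

lemma powerSum_zero (f : ℕ → ℂ) : powerSum f 0 = f 0 := by
  rw [powerSum, tsum_eq_single 0 (fun n hn => by simp [hn])]
  simp

lemma PolyBounded.hasSum {f : ℕ → ℂ} (hf : PolyBounded f) {z : ℂ} (hz : ‖z‖ < 1) :
    HasSum (fun n => f n * z ^ n) (powerSum f z) := by
  refine Summable.hasSum (Summable.of_norm ?_)
  simpa using hf.summable_norm (norm_nonneg z) hz

lemma PolyBounded.powerSum_eq {f : ℕ → ℂ} (hf : PolyBounded f) {z : ℂ} (hz : ‖z‖ < 1) :
    powerSum f z = f 0 + z * powerSum (fun n => f (n + 1)) z := by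
  refine (hf.hasSum hz).unique ?_
  rw [← hasSum_nat_add_iff' 1]
  simpa [pow_succ', mul_left_comm] using (hf.succ.hasSum hz).mul_left z

lemma PolyBounded.mul_powerSum_deriv {f : ℕ → ℂ} (hf : PolyBounded f) {z : ℂ} (hz : ‖z‖ < 1) :
    z * powerSum (fun n => ((n + 1 : ℕ) : ℂ) * f (n + 1)) z =
      powerSum (fun n => (n : ℂ) * f n) z := by
  rw [hf.natCast_mul.powerSum_eq hz]
  simp

lemma PolyBounded.hasDerivAt {f : ℕ → ℂ} (hf : PolyBounded f) {z : ℂ} (hz : ‖z‖ < 1) :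
    HasDerivAt (powerSum f) (powerSum (fun n => ((n + 1 : ℕ) : ℂ) * f (n + 1)) z) z := by
  obtain ⟨r, hzr, hr⟩ := exists_between hz
  have hr0 : 0 ≤ r := (norm_nonneg z).trans hzr.le
  have hu : Summable fun n : ℕ => ‖f n * (n * (r : ℂ) ^ (n - 1))‖ := by
    rw [← summable_nat_add_iff 1]
    refine (hf.deriv.summable_norm hr0 hr).congr fun n => ?_
    simp only [norm_mul, norm_pow, norm_real, Real.norm_of_nonneg hr0, Nat.add_sub_cancel]
    ring
  have h := hasDerivAt_tsum_of_isPreconnected (t := Metric.ball (0 : ℂ) r) (y₀ := 0) (y := z)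
    (g := fun n w => f n * w ^ n) (g' := fun n w => f n * (n * w ^ (n - 1))) hu
    Metric.isOpen_ball (convex_ball _ _).isPreconnected
    (fun n w _ => (hasDerivAt_pow n w).const_mul (f n))
    (fun n w hw => by
      have hw' : ‖w‖ ≤ r := by simpa using (Metric.mem_ball.1 hw).le
      simp only [norm_mul, norm_pow, norm_real, Real.norm_of_nonneg hr0]
      gcongr)
    (by simpa using (norm_nonneg z).trans_lt hzr)
    (hf.hasSum (z := 0) (by simp)).summable (by simpa using hzr)
  refine h.congr_deriv ?_
  have h' : Summable fun n : ℕ => f n * ((n : ℂ) * z ^ (n - 1)) := by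
    refine Summable.of_norm ?_
    rw [← summable_nat_add_iff 1]
    refine (hf.deriv.summable_norm (norm_nonneg z) hz).congr fun n => ?_
    simp only [norm_mul, norm_pow, Nat.add_sub_cancel]
    ring
  rw [h'.tsum_eq_zero_add]
  simp only [Nat.cast_zero, zero_mul, mul_zero, zero_add, powerSum, Nat.add_sub_cancel]
  exact tsum_congr fun n => by ring

/-- The Weierstrass test reaches the closed disc, so that boundary values at `z = 1` are sums of
coefficients. -/
lemma continuousOn_powerSum {f : ℕ → ℂ} (hf : Summable fun n => ‖f n‖) :
    ContinuousOn (powerSum f) (Metric.closedBall 0 1) := by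
  refine continuousOn_tsum (fun n => by fun_prop) hf fun n z hz => ?_
  rw [norm_mul, norm_pow]
  exact mul_le_of_le_one_right (norm_nonneg _)
    (pow_le_one₀ (norm_nonneg _) (by simpa using hz))

/-! ### Coefficient relations behind the first hypergeometric solution -/

lemma polyBounded_hyperCoeff (a b d : ℂ) : PolyBounded (hyperCoeff a b d) := by
  obtain ⟨K, hK⟩ := exists_norm_hyperCoeff_le a b d
  obtain ⟨p, hp⟩ := exists_nat_ge (a.re + b.re - d.re - 1)
  refine ⟨|K| + 1 + ‖hyperCoeff a b d 1‖, p, fun n => ?_⟩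
  have hone : (1 : ℝ) ≤ ((n : ℝ) + 1) ^ p := one_le_pow₀ (by linarith [n.cast_nonneg (α := ℝ)])
  match n with
  | 0 =>
    refine le_trans ?_ (mul_le_mul_of_nonneg_left hone (by positivity))
    rw [hyperCoeff_zero, norm_one]
    linarith [abs_nonneg K, norm_nonneg (hyperCoeff a b d 1)]
  | 1 =>
    refine le_trans ?_ (mul_le_mul_of_nonneg_left hone (by positivity))
    linarith [abs_nonneg K]
  | n + 2 =>
    refine (hK (n + 1) n.succ_ne_zero).trans ?_
    have h1 : ((n + 1 : ℕ) : ℝ) ^ (a.re + b.re - d.re - 1) ≤ (((n + 2 : ℕ) : ℝ) + 1) ^ p := by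
      calc ((n + 1 : ℕ) : ℝ) ^ (a.re + b.re - d.re - 1)
          ≤ ((n + 1 : ℕ) : ℝ) ^ (p : ℝ) := Real.rpow_le_rpow_of_exponent_le (by simp) hp
        _ = ((n + 1 : ℕ) : ℝ) ^ p := Real.rpow_natCast _ _
        _ ≤ _ := by gcongr; push_cast; linarith
    exact mul_le_mul (by linarith [le_abs_self K, norm_nonneg (hyperCoeff a b d 1)]) h1
      (by positivity) (by positivity)

/-- The relation between the coefficients of `₂F₁(ic, -ic; d)` and of its derivative. -/
lemma succ_mul_hyperCoeff (c : ℂ) {d : ℂ} (hd : 0 < d.re) (n : ℕ) :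
    ((n + 1 : ℕ) : ℂ) * hyperCoeff (I * c) (-(I * c)) d (n + 1) =
      c * (c / d * hyperCoeff (1 + I * c) (1 - I * c) (d + 1) n) := by
  have hd0 : d ≠ 0 := by simpa using add_natCast_ne_zero hd 0
  induction n with
  | zero =>
    simp [hyperCoeff_succ]
    field_simp
    linear_combination (-c ^ 2) * I_sq
  | succ n ih =>
    have h1 := add_natCast_ne_zero hd n
    have h2 := add_natCast_ne_zero (d := d + 1) (by simp; linarith) n
    have h3 := one_add_natCast_ne_zero n
    have h4 := one_add_natCast_ne_zero (n + 1)
    have h5 := add_natCast_ne_zero hd (n + 1)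
    have h6 : hyperCoeff (I * c) (-(I * c)) d (n + 1) =
        c * (c / d * hyperCoeff (1 + I * c) (1 - I * c) (d + 1) n) / (1 + n) := by
      rw [← ih]; push_cast; field_simp; ring
    rw [hyperCoeff_succ _ _ _ (n + 1), h6, hyperCoeff_succ]
    push_cast at *
    have h7 : d + ((n : ℂ) + 1) = d + 1 + n := by ring
    rw [h7]
    field_simp
    ring

/-- With `f` and `g` the two series involved, this is the coefficient of `z^(n+1)` in `z(1-z) g' =
(z-d) g + c f`. -/
lemma hyperCoeff_recurrence (c : ℂ) {d : ℂ} (hd : 0 < d.re) (n : ℕ) :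
    (n + 1 + d) * (c / d * hyperCoeff (1 + I * c) (1 - I * c) (d + 1) (n + 1)) =
      (n + 1) * (c / d * hyperCoeff (1 + I * c) (1 - I * c) (d + 1) n) +
        c * hyperCoeff (I * c) (-(I * c)) d (n + 1) := by
  have hd0 : d ≠ 0 := by simpa using add_natCast_ne_zero hd 0
  have h2 := add_natCast_ne_zero (d := d + 1) (by simp; linarith) n
  have h3 := one_add_natCast_ne_zero n
  have h6 : hyperCoeff (I * c) (-(I * c)) d (n + 1) =
      c * (c / d * hyperCoeff (1 + I * c) (1 - I * c) (d + 1) n) / (1 + n) := by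
    rw [← succ_mul_hyperCoeff c hd]; push_cast; field_simp; ring
  rw [h6, hyperCoeff_succ]
  generalize hyperCoeff (1 + I * c) (1 - I * c) (d + 1) n = h
  field_simp
  linear_combination (-c ^ 3 * (n + 1 + d) * h) * I_sq

/-! ### The reduced linear system and the variable `s = sigmoid (2y) = (1 + tanh y)/2` -/

/-- The linear problem for the amplitudes in the variable `y = A (x - x₀)`. -/
def IsAmplitude (c κ : ℂ) (U R : ℝ → ℂ) : Prop :=
  ∀ y : ℝ, HasDerivAt U (c / Complex.cosh y * R y) y ∧
    HasDerivAt R (2 * I * κ * R y + c / Complex.cosh y * U y) y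

lemma cosh_ofReal_ne_zero (y : ℝ) : Complex.cosh y ≠ 0 := by
  rw [← ofReal_cosh]
  exact_mod_cast (Real.cosh_pos y).ne'

lemma sigmoid_mul_cosh (y : ℝ) :
    (Real.sigmoid (2 * y) : ℂ) * (2 * Complex.cosh y) = Complex.exp y := by
  have h : Real.sigmoid (2 * y) * (2 * Real.cosh y) = Real.exp y := by
    have h2 : Real.exp (-(2 * y)) = Real.exp (-y) * Real.exp (-y) := by
      rw [← Real.exp_add]; ring_nf
    have h3 : Real.exp y * Real.exp (-y) = 1 := by rw [← Real.exp_add]; simp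
    have h4 : 1 + Real.exp (-(2 * y)) ≠ 0 := by positivity
    rw [Real.sigmoid_def, Real.cosh_eq, inv_mul_eq_iff_eq_mul₀ h4, h2]
    linear_combination (-Real.exp (-y)) * h3
  exact_mod_cast congrArg ((↑) : ℝ → ℂ) h

lemma one_sub_sigmoid_mul_cosh (y : ℝ) :
    (1 - (Real.sigmoid (2 * y) : ℂ)) * (2 * Complex.cosh y) = Complex.exp (-y) := by
  have h := sigmoid_mul_cosh y
  rw [sub_mul, h, one_mul, two_cosh]
  ring

lemma hasDerivAt_sigmoid_two_mul (y : ℝ) :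
    HasDerivAt (fun y : ℝ => Real.sigmoid (2 * y))
      (2 * Real.sigmoid (2 * y) * (1 - Real.sigmoid (2 * y))) y := by
  have h := (Real.hasDerivAt_sigmoid (2 * y)).comp y ((hasDerivAt_id y).const_mul 2)
  refine h.congr_deriv ?_
  ring

lemma norm_sigmoid_lt_one (y : ℝ) : ‖(Real.sigmoid (2 * y) : ℂ)‖ < 1 := by
  rw [norm_real, Real.norm_of_nonneg (Real.sigmoid_nonneg _)]
  exact Real.sigmoid_lt_one _

lemma tendsto_sigmoid_two_mul_atTop :
    Tendsto (fun y : ℝ => (Real.sigmoid (2 * y) : ℂ)) atTop (𝓝 1) := by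
  have h := Real.tendsto_sigmoid_atTop.comp (tendsto_id.const_mul_atTop (zero_lt_two' ℝ))
  simpa [Function.comp_def] using (continuous_ofReal.tendsto 1).comp h

lemma tendsto_sigmoid_two_mul_atBot :
    Tendsto (fun y : ℝ => (Real.sigmoid (2 * y) : ℂ)) atBot (𝓝 0) := by
  have h := Real.tendsto_sigmoid_atBot.comp (tendsto_id.const_mul_atBot (zero_lt_two' ℝ))
  simpa [Function.comp_def] using (continuous_ofReal.tendsto 0).comp h

lemma PolyBounded.hasDerivAt_comp_sigmoid {f : ℕ → ℂ} (hf : PolyBounded f) (y : ℝ) :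
    HasDerivAt (fun y : ℝ => powerSum f (Real.sigmoid (2 * y)))
      (2 * Real.sigmoid (2 * y) * (1 - Real.sigmoid (2 * y)) *
        powerSum (fun n => ((n + 1 : ℕ) : ℂ) * f (n + 1)) (Real.sigmoid (2 * y))) y := by
  have h := (hf.hasDerivAt (norm_sigmoid_lt_one y)).comp y
    (hasDerivAt_sigmoid_two_mul y).ofReal_comp
  refine h.congr_deriv ?_
  push_cast
  ring

lemma PolyBounded.tendsto_atBot {f : ℕ → ℂ} (hf : PolyBounded f) :
    Tendsto (fun y : ℝ => powerSum f (Real.sigmoid (2 * y))) atBot (𝓝 (f 0)) := by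
  have h := (hf.hasDerivAt (z := 0) (by simp)).continuousAt.tendsto
  rw [powerSum_zero] at h
  exact h.comp tendsto_sigmoid_two_mul_atBot

lemma tendsto_powerSum_atTop {f : ℕ → ℂ} (hf : Summable fun n => ‖f n‖) :
    Tendsto (fun y : ℝ => powerSum f (Real.sigmoid (2 * y))) atTop (𝓝 (∑' n, f n)) := by
  have h := continuousOn_powerSum hf 1 (by simp)
  have h1 : powerSum f 1 = ∑' n, f n := by simp [powerSum]
  rw [ContinuousWithinAt, h1] at h
  exact h.comp (tendsto_nhdsWithin_iff.2 ⟨tendsto_sigmoid_two_mul_atTop,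
    .of_forall fun y => by simpa using (norm_sigmoid_lt_one y).le⟩)

lemma norm_inv_cosh_le (y : ℝ) : ‖(Complex.cosh y)⁻¹‖ ≤ 2 * Real.exp (-y) := by
  rw [← ofReal_cosh, norm_inv, norm_real, Real.norm_of_nonneg (Real.cosh_pos y).le,
    inv_le_iff_one_le_mul₀ (Real.cosh_pos y), Real.cosh_eq]
  have h3 : Real.exp (-y) * Real.exp y = 1 := by rw [← Real.exp_add]; simp
  nlinarith [Real.exp_pos (-y)]

lemma tendsto_inv_cosh_atTop : Tendsto (fun y : ℝ => (Complex.cosh y)⁻¹) atTop (𝓝 0) := by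
  refine squeeze_zero_norm norm_inv_cosh_le ?_
  simpa using (Real.tendsto_exp_neg_atTop_nhds_zero).const_mul 2

lemma tendsto_inv_cosh_atBot : Tendsto (fun y : ℝ => (Complex.cosh y)⁻¹) atBot (𝓝 0) := by
  have h := tendsto_inv_cosh_atTop.comp tendsto_neg_atBot_atTop
  refine h.congr fun y => ?_
  simp

/-- Since `∫ e^{-t} dt ≤ 1` on `[0, y]`, the bound does not deteriorate with `y`. With `sech t ≤
2e^{-t}` it bounds one amplitude by the other. -/
lemma norm_le_of_norm_deriv_le_exp_neg {f f' : ℝ → ℂ} {K y : ℝ} (hK : 0 ≤ K) (hy : 0 ≤ y)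
    (hf : ∀ t, HasDerivAt f (f' t) t)
    (hb : ∀ t ∈ Set.Icc 0 y, ‖f' t‖ ≤ K * Real.exp (-t)) : ‖f y‖ ≤ ‖f 0‖ + K := by
  have h := image_norm_le_of_norm_deriv_right_le_deriv_boundary (a := 0) (b := y) (f := f)
    (f' := f') (B := fun t => ‖f 0‖ + K * (1 - Real.exp (-t))) (B' := fun t => K * Real.exp (-t))
    (fun t _ => (hf t).continuousAt.continuousWithinAt) (fun t _ => (hf t).hasDerivWithinAt)
    (by simp)
    (fun t => by
      have h := (((hasDerivAt_neg t).exp.const_sub 1).const_mul K).const_add ‖f 0‖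
      refine h.congr_deriv ?_
      ring)
    (fun t ht => hb t ⟨ht.1, ht.2.le⟩) (Set.right_mem_Icc.2 hy)
  have := mul_nonneg hK (Real.exp_pos (-y)).le
  linarith

/-- If one amplitude is bounded on the right half-line, so is the other. -/
lemma IsAmplitude.bounded_fst {c κ : ℂ} {U R : ℝ → ℂ} (h : IsAmplitude c κ U R)
    (hR : ∃ K, ∀ y, 0 ≤ y → ‖R y‖ ≤ K) : ∃ K, ∀ y, 0 ≤ y → ‖U y‖ ≤ K := by
  obtain ⟨K, hK⟩ := hR
  have hK0 : 0 ≤ K := (norm_nonneg _).trans (hK 0 le_rfl)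
  refine ⟨‖U 0‖ + ‖c‖ * 2 * K, fun y hy => norm_le_of_norm_deriv_le_exp_neg (by positivity) hy
    (fun t => (h t).1) fun t ht => ?_⟩
  have h1 := norm_inv_cosh_le t
  rw [div_eq_mul_inv, norm_mul, norm_mul]
  calc ‖c‖ * ‖(Complex.cosh t)⁻¹‖ * ‖R t‖ ≤ ‖c‖ * (2 * Real.exp (-t)) * K := by
        gcongr
        exact hK t ht.1
    _ = _ := by ring

lemma IsAmplitude.bounded_snd {c κ : ℂ} {U R : ℝ → ℂ} (h : IsAmplitude c κ U R)
    (hκ : 0 ≤ κ.im) (hU : ∃ K, ∀ y, 0 ≤ y → ‖U y‖ ≤ K) : ∃ K, ∀ y, 0 ≤ y → ‖R y‖ ≤ K := by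
  obtain ⟨K, hK⟩ := hU
  have hK0 : 0 ≤ K := (norm_nonneg _).trans (hK 0 le_rfl)
  have hnorm : ∀ t : ℝ, ‖Complex.exp (-(2 * I * κ * t))‖ = Real.exp (2 * κ.im * t) := fun t => by
    rw [norm_exp]
    simp
  refine ⟨‖R 0‖ + ‖c‖ * 2 * K, fun y hy => ?_⟩
  have hd : ∀ t : ℝ, HasDerivAt (fun t : ℝ => Complex.exp (-(2 * I * κ * t)) * R t)
      (Complex.exp (-(2 * I * κ * t)) * (c / Complex.cosh t * U t)) t := fun t => by
    have h1 : HasDerivAt (fun t : ℝ => -(2 * I * κ * (t : ℂ))) (-(2 * I * κ * 1)) t :=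
      ((hasDerivAt_id t).ofReal_comp.const_mul (2 * I * κ)).neg
    refine (h1.cexp.mul (h t).2).congr_deriv ?_
    ring
  -- The integrating factor has norm `e^{2 Im κ t}`, nondecreasing because `Im κ ≥ 0`, so its value
  -- at the endpoint `y` can be put into the constant and divided out at the end.
  have h1 := norm_le_of_norm_deriv_le_exp_neg
    (K := Real.exp (2 * κ.im * y) * (‖c‖ * 2 * K)) (by positivity) hy hd fun t ht => by
      have h1 := norm_inv_cosh_le t
      rw [norm_mul, hnorm, div_eq_mul_inv, norm_mul, norm_mul]
      calc Real.exp (2 * κ.im * t) * (‖c‖ * ‖(Complex.cosh t)⁻¹‖ * ‖U t‖)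
          ≤ Real.exp (2 * κ.im * y) * (‖c‖ * (2 * Real.exp (-t)) * K) := by
            gcongr
            · exact ht.2
            · exact hK t ht.1
        _ = _ := by ring
  have h2 : 1 ≤ Real.exp (2 * κ.im * y) := Real.one_le_exp (by positivity)
  rw [norm_mul, hnorm] at h1
  simp only [ofReal_zero, mul_zero, neg_zero, Complex.exp_zero, one_mul] at h1
  have h3 : Real.exp (2 * κ.im * y) * ‖R y‖ ≤
      Real.exp (2 * κ.im * y) * (‖R 0‖ + ‖c‖ * 2 * K) := by
    nlinarith [norm_nonneg (R 0)]
  exact le_of_mul_le_mul_left h3 (Real.exp_pos _)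

/-! ### Hypergeometric solutions of the reduced system -/

/-- The transmission coefficient in reduced variables. -/
def transmission (c κ : ℂ) : ℂ :=
  Gamma (1 / 2 - I * κ) ^ 2 / (Gamma (1 / 2 - I * c - I * κ) * Gamma (1 / 2 + I * c - I * κ))

/-- The reflection coefficient in reduced variables. -/
def reflection (c κ : ℂ) : ℂ := Complex.sin (I * Real.pi * c) / I / Complex.cosh (Real.pi * κ)

/-- `U = f(s)` and `R = (sech y / 2) g(s)` with `f' = c g`: the first equation is the chain rule,
the second is the differential equation for `g`. Gauss's theorem gives the limit of `U`. The series
for `g` need not converge at `s = 1`, so `R` is bounded through the system itself rather than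
through the series. -/
theorem exists_isAmplitude (c : ℂ) {κ : ℂ} (hκ : 0 ≤ κ.im) :
    ∃ U R : ℝ → ℂ, IsAmplitude c κ U R ∧ Tendsto U atBot (𝓝 1) ∧ Tendsto R atBot (𝓝 0) ∧
      Tendsto U atTop (𝓝 (transmission c κ)) ∧ ∃ K, ∀ y, 0 ≤ y → ‖R y‖ ≤ K := by
  set d : ℂ := 1 / 2 - I * κ with hd_def
  have hd : 0 < d.re := by
    simp [hd_def]; linarith
  have hd0 : d ≠ 0 := by simpa using add_natCast_ne_zero hd 0
  set f := hyperCoeff (I * c) (-(I * c)) d with hf_def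
  set g := fun n => c / d * hyperCoeff (1 + I * c) (1 - I * c) (d + 1) n with hg_def
  have hf : PolyBounded f := polyBounded_hyperCoeff _ _ _
  have hg : PolyBounded g := (polyBounded_hyperCoeff _ _ _).const_mul _
  have hsum : (I * c).re + (-(I * c)).re < d.re := by
    simpa using hd
  have hfs : Summable fun n => ‖f n‖ := summable_hyperCoeff hsum
  have hfg : ∀ z, powerSum (fun n => ((n + 1 : ℕ) : ℂ) * f (n + 1)) z = c * powerSum g z := by
    intro z
    simp_rw [hf_def, succ_mul_hyperCoeff c hd]
    simp only [powerSum, ← tsum_mul_left, hg_def]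
    exact tsum_congr fun n => by ring
  have hode : ∀ z : ℂ, ‖z‖ < 1 →
      z * (1 - z) * powerSum (fun n => ((n + 1 : ℕ) : ℂ) * g (n + 1)) z =
        (z - d) * powerSum g z + c * powerSum f z := by
    intro z hz
    have h1 := hg.mul_powerSum_deriv hz
    have h2 := hg.powerSum_eq hz
    have h3 := hf.powerSum_eq hz
    have h4 : powerSum (fun n => ((n + 1 : ℕ) : ℂ) * g (n + 1)) z +
        d * powerSum (fun n => g (n + 1)) z = powerSum (fun n => (n : ℂ) * g n) z +
        powerSum g z + c * powerSum (fun n => f (n + 1)) z := by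
      refine ((hg.deriv.hasSum hz).add ((hg.succ.hasSum hz).mul_left d)).unique ?_
      refine (((hg.natCast_mul.hasSum hz).add (hg.hasSum hz)).add
        ((hf.succ.hasSum hz).mul_left c)).congr_fun fun n => ?_
      have := hyperCoeff_recurrence c hd n
      simp only [hg_def, hf_def]
      push_cast
      linear_combination z ^ n * this
    have hg0 : g 0 = c / d := by simp [hg_def]
    have hf0 : f 0 = 1 := by simp [hf_def]
    rw [hg0] at h2
    rw [hf0] at h3
    have h5 : d * (c / d) = c := by field_simp
    linear_combination z * h4 - z * h1 + d * h2 - c * h3 + h5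
  have hamp : IsAmplitude c κ (fun y => powerSum f (Real.sigmoid (2 * y)))
      (fun y => (Complex.cosh y)⁻¹ / 2 * powerSum g (Real.sigmoid (2 * y))) := by
    intro y
    set s : ℂ := (Real.sigmoid (2 * y) : ℂ) with hs_def
    have hs1 := sigmoid_mul_cosh y
    have hs2 := one_sub_sigmoid_mul_cosh y
    rw [← hs_def] at hs1 hs2
    have hch := cosh_ofReal_ne_zero y
    have h4 : 4 * s * (1 - s) = (Complex.cosh y)⁻¹ ^ 2 := by
      have : Complex.exp y * Complex.exp (-y) = 1 := by rw [← Complex.exp_add]; simp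
      rw [← hs1, ← hs2] at this
      field_simp
      linear_combination this
    have hsh : Complex.sinh y = (2 * s - 1) * Complex.cosh y := by
      have := two_sinh (y : ℂ)
      rw [← hs1, ← hs2] at this
      linear_combination this / 2
    constructor
    · refine (hf.hasDerivAt_comp_sigmoid y).congr_deriv ?_
      rw [hfg, ← hs_def]
      linear_combination (c * powerSum g s / 2) * h4
    · have hcd : HasDerivAt (fun y : ℝ => (Complex.cosh y)⁻¹ / 2)
          ((1 - 2 * s) * (Complex.cosh y)⁻¹ / 2) y := by
        have := ((Complex.hasDerivAt_cosh (y : ℂ)).comp_ofReal.inv hch).div_const 2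
        refine this.congr_deriv ?_
        rw [hsh]
        field_simp
        ring
      refine (hcd.mul (hg.hasDerivAt_comp_sigmoid y)).congr_deriv ?_
      rw [← hs_def]
      have := hode s (norm_sigmoid_lt_one y)
      have hκd : 2 * I * κ = 1 - 2 * d := by rw [hd_def]; ring
      rw [hκd]
      linear_combination (Complex.cosh y)⁻¹ * this
  have htop : Tendsto (fun y : ℝ => powerSum f (Real.sigmoid (2 * y))) atTop
      (𝓝 (transmission c κ)) := by
    have h := tendsto_powerSum_atTop hfs
    rw [hf_def, tsum_hyperCoeff hd hsum] at h
    convert h using 2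
    rw [transmission, ← hd_def, sq]
    have h1 : d - I * c - -(I * c) = d := by ring
    have h2 : d - I * c = 1 / 2 - I * c - I * κ := by rw [hd_def]; ring
    have h3 : d - -(I * c) = 1 / 2 + I * c - I * κ := by rw [hd_def]; ring
    rw [h1, h2, h3]
  refine ⟨_, _, hamp, ?_, ?_, htop, hamp.bounded_snd hκ ?_⟩
  · simpa [hf_def] using hf.tendsto_atBot
  · simpa using (tendsto_inv_cosh_atBot.div_const 2).mul hg.tendsto_atBot
  · have hb := continuousOn_powerSum hfs
    obtain ⟨K, hK⟩ := (isCompact_closedBall (0 : ℂ) 1).exists_bound_of_continuousOn hb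
    exact ⟨K, fun y _ => hK _ (by simpa using (norm_sigmoid_lt_one y).le)⟩

/-- The reflection formula is used twice: for `Γ(d) Γ(1-d)`, where `sin πd = cosh πκ`, and for
`Γ(1+ic) Γ(1-ic)`. The latter divides by `ic`, hence the separate case `c = 0`. -/
lemma reflection_eq (c κ : ℂ) (hκ : κ.im = 0) :
    c / (1 / 2 - I * κ) * (Gamma (1 / 2 - I * κ + 1) * Gamma (1 - (1 / 2 - I * κ)) /
      (Gamma (1 + I * c) * Gamma (1 - I * c))) = reflection c κ := by
  have hd0 : 1 / 2 - I * κ ≠ 0 := by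
    intro h
    have := congrArg Complex.re h
    simp [hκ] at this
  have hsin : Complex.sin (Real.pi * (1 / 2 - I * κ)) = Complex.cosh (Real.pi * κ) := by
    have h : (Real.pi : ℂ) * (1 / 2 - I * κ) = Real.pi / 2 - Real.pi * κ * I := by ring
    rw [h, Complex.sin_pi_div_two_sub, Complex.cos_mul_I]
  rcases eq_or_ne c 0 with rfl | hc
  · simp [reflection]
  have hic : I * c ≠ 0 := mul_ne_zero I_ne_zero hc
  have h1 : Gamma (1 + I * c) * Gamma (1 - I * c) =
      I * c * (Real.pi / Complex.sin (Real.pi * (I * c))) := by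
    rw [← Gamma_mul_Gamma_one_sub, add_comm, Gamma_add_one _ hic]
    ring
  rw [h1, Gamma_add_one _ hd0, mul_assoc, Gamma_mul_Gamma_one_sub, hsin, reflection]
  have hpi : (Real.pi : ℂ) ≠ 0 := by exact_mod_cast Real.pi_ne_zero
  have h2 : (Real.pi : ℂ) * (I * c) = I * Real.pi * c := by ring
  have hI := I_ne_zero
  rw [h2]
  clear hsin h1
  generalize 1 / 2 - I * κ = e at *
  simp only [div_eq_mul_inv, mul_inv, inv_inv]
  field_simp

/-- For a real spectral parameter the amplitudes have a representation that displays the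
reflection coefficient. -/
theorem exists_isAmplitude_of_im_eq_zero (c : ℂ) {κ : ℂ} (hκ : κ.im = 0) :
    ∃ U R : ℝ → ℂ, IsAmplitude c κ U R ∧ Tendsto U atBot (𝓝 1) ∧ Tendsto R atBot (𝓝 0) ∧
      (∃ K, ∀ y, 0 ≤ y → ‖U y‖ ≤ K) ∧
      Tendsto (fun y : ℝ => Complex.exp (-(2 * I * κ * y)) * R y) atTop
        (𝓝 (reflection c κ)) := by
  set d : ℂ := 1 / 2 - I * κ with hd_def
  have hdre : d.re = 1 / 2 := by simp [hd_def, hκ]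
  have hd : 0 < d.re := by rw [hdre]; norm_num
  have hd0 : d ≠ 0 := by simpa using add_natCast_ne_zero hd 0
  -- Euler's transformation suggests `U = (1-s)^d h(s)` and `R = (c/d) e^{2iκy} s^d g(s)`. At `s =
  -- 1` the series `g` has Gauss exponent `1 - d`, of real part `1/2`, so it converges absolutely;
  -- for `h` the exponent is `-d`, and `U` is only shown to be bounded, via `R`.
  set h := hyperCoeff (d - I * c) (d + I * c) d with hh_def
  set g := hyperCoeff (d - I * c) (d + I * c) (d + 1) with hg_def
  have hh : PolyBounded h := polyBounded_hyperCoeff _ _ _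
  have hg : PolyBounded g := polyBounded_hyperCoeff _ _ _
  have hsum : (d - I * c).re + (d + I * c).re < (d + 1).re := by
    simp only [sub_re, add_re, one_re]
    linarith
  have hgs : Summable fun n => ‖g n‖ := summable_hyperCoeff hsum
  have hgh : ∀ n : ℕ, g n * (d + n) = d * h n := fun n => hyperCoeff_div_add hd n
  have hode1 : ∀ z : ℂ, ‖z‖ < 1 →
      z * powerSum (fun n => ((n + 1 : ℕ) : ℂ) * g (n + 1)) z + d * powerSum g z =
        d * powerSum h z := by
    intro z hz
    rw [hg.mul_powerSum_deriv hz]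
    refine ((hg.natCast_mul.hasSum hz).add ((hg.hasSum hz).mul_left d)).unique ?_
    refine ((hh.hasSum hz).mul_left d).congr_fun fun n => ?_
    linear_combination z ^ n * hgh n
  have hode2 : ∀ z : ℂ, ‖z‖ < 1 →
      (1 - z) * powerSum (fun n => ((n + 1 : ℕ) : ℂ) * h (n + 1)) z =
        d * powerSum h z + c ^ 2 / d * powerSum g z := by
    intro z hz
    have h1 := hh.mul_powerSum_deriv hz
    have h2 : powerSum (fun n => ((n + 1 : ℕ) : ℂ) * h (n + 1)) z =
        powerSum (fun n => (n : ℂ) * h n) z + d * powerSum h z + c ^ 2 / d * powerSum g z := by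
      refine (hh.deriv.hasSum hz).unique ?_
      refine (((hh.natCast_mul.hasSum hz).add ((hh.hasSum hz).mul_left d)).add
        ((hg.hasSum hz).mul_left (c ^ 2 / d))).congr_fun fun n => ?_
      have hdn := add_natCast_ne_zero hd n
      have hn := one_add_natCast_ne_zero n
      have h3 : h n = g n * (d + n) / d := by rw [hgh]; field_simp
      rw [hh_def, hyperCoeff_succ, ← hh_def, h3]
      push_cast
      generalize g n = G
      field_simp
      linear_combination (-c ^ 2 * G * z ^ n * (1 + n)) * I_sq
    linear_combination h2 - h1
  -- `L = log s` and `L - 2y = log (1 - s)` are real logarithms, so the complex powers `s^d` and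
  -- `(1-s)^d` involve no choice of branch.
  set L : ℝ → ℂ := fun y => (Real.log (Real.sigmoid (2 * y)) : ℂ) with hL_def
  have hLd : ∀ y, HasDerivAt L (2 * (1 - Real.sigmoid (2 * y))) y := fun y => by
    have hpos := Real.sigmoid_pos (2 * y)
    have h := ((hasDerivAt_sigmoid_two_mul y).log hpos.ne').ofReal_comp
    refine h.congr_deriv ?_
    have : (Real.sigmoid (2 * y) : ℂ) ≠ 0 := by exact_mod_cast hpos.ne'
    push_cast
    field_simp
  have hLtop : Tendsto L atTop (𝓝 0) := by
    have h1 := Real.tendsto_sigmoid_atTop.comp (tendsto_id.const_mul_atTop (zero_lt_two' ℝ))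
    have h2 := (Real.continuousAt_log one_ne_zero).tendsto.comp h1
    rw [Real.log_one] at h2
    simpa [Function.comp_def] using (continuous_ofReal.tendsto 0).comp h2
  have hLbot : Tendsto (fun y => L y - 2 * y) atBot (𝓝 0) := by
    have h1 : ∀ y : ℝ, L y - 2 * y = L (-y) := fun y => by
      have h2 : Real.sigmoid (2 * y) * Real.exp (-(2 * y)) = Real.sigmoid (2 * -y) := by
        rw [Real.sigmoid_mul_rexp_neg]; ring_nf
      simp only [hL_def]
      rw [← h2, Real.log_mul (Real.sigmoid_pos _).ne' (Real.exp_pos _).ne', Real.log_exp]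
      push_cast
      ring
    simp_rw [h1]
    exact hLtop.comp tendsto_neg_atBot_atTop
  have hamp : IsAmplitude c κ
      (fun y => Complex.exp (d * (L y - 2 * y)) * powerSum h (Real.sigmoid (2 * y)))
      (fun y => c / d * (Complex.exp (2 * I * κ * y + d * L y) *
        powerSum g (Real.sigmoid (2 * y)))) := by
    intro y
    set s : ℂ := (Real.sigmoid (2 * y) : ℂ) with hs_def
    have hs1 := sigmoid_mul_cosh y
    have hs2 := one_sub_sigmoid_mul_cosh y
    rw [← hs_def] at hs1 hs2
    have hch := cosh_ofReal_ne_zero y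
    have hs : ‖s‖ < 1 := norm_sigmoid_lt_one y
    have hyd : HasDerivAt (fun y : ℝ => (y : ℂ)) 1 y := (hasDerivAt_id y).ofReal_comp
    have hE : Complex.exp (2 * I * κ * y + d * L y) =
        Complex.exp (d * (L y - 2 * y)) * Complex.exp y := by
      rw [← Complex.exp_add, hd_def]
      congr 1
      ring
    have hE' : Complex.exp (d * (L y - 2 * y)) =
        Complex.exp (2 * I * κ * y + d * L y) * Complex.exp (-y) := by
      rw [hE, mul_assoc, ← Complex.exp_add]
      simp
    constructor
    · have hM : HasDerivAt (fun y : ℝ => d * (L y - 2 * y)) (d * (-(2 * s))) y := by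
        refine (((hLd y).sub (hyd.const_mul 2)).const_mul d).congr_deriv ?_
        rw [← hs_def]
        ring
      refine (hM.cexp.mul (hh.hasDerivAt_comp_sigmoid y)).congr_deriv ?_
      beta_reduce
      rw [← hs_def, hE, ← hs1]
      have := hode2 s hs
      field_simp at this ⊢
      linear_combination s * this
    · have hM : HasDerivAt (fun y : ℝ => 2 * I * κ * y + d * L y)
          (2 * I * κ + d * (2 * (1 - s))) y := by
        refine ((hyd.const_mul (2 * I * κ)).add ((hLd y).const_mul d)).congr_deriv ?_
        rw [← hs_def]
        ring
      refine ((hM.cexp.mul (hg.hasDerivAt_comp_sigmoid y)).const_mul (c / d)).congr_deriv ?_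
      beta_reduce
      rw [← hs_def, hE', ← hs2]
      have := hode1 s hs
      field_simp
      linear_combination c * (1 - s) * this
  have hRexp : ∀ y : ℝ, Complex.exp (-(2 * I * κ * y)) *
      (c / d * (Complex.exp (2 * I * κ * y + d * L y) * powerSum g (Real.sigmoid (2 * y)))) =
      c / d * (Complex.exp (d * L y) * powerSum g (Real.sigmoid (2 * y))) := fun y => by
    have : Complex.exp (d * L y) =
        Complex.exp (-(2 * I * κ * y)) * Complex.exp (2 * I * κ * y + d * L y) := by
      rw [← Complex.exp_add]; congr 1; ring
    rw [this]
    ring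
  have hnorm : ∀ y : ℝ, ‖Complex.exp (2 * I * κ * y)‖ = 1 := fun y => by
    rw [norm_exp]
    simp [hκ]
  refine ⟨_, _, hamp, ?_, ?_, hamp.bounded_fst ?_, ?_⟩
  · have h1 := ((hLbot.const_mul d).cexp).mul hh.tendsto_atBot
    simpa [hh_def] using h1
  · have hexp : Tendsto (fun y => Complex.exp (2 * I * κ * y + d * L y)) atBot (𝓝 0) := by
      rw [tendsto_zero_iff_norm_tendsto_zero]
      have h1 : Tendsto (fun y : ℝ => Real.sqrt (Real.sigmoid (2 * y))) atBot (𝓝 0) := by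
        have h1 := Real.tendsto_sigmoid_atBot.comp (tendsto_id.const_mul_atBot (zero_lt_two' ℝ))
        simpa [Function.comp_def] using (Real.continuous_sqrt.tendsto 0).comp h1
      refine h1.congr fun y => ?_
      rw [Complex.exp_add, norm_mul, hnorm, one_mul, norm_exp, hL_def, re_mul_ofReal, hdre,
        Real.sqrt_eq_rpow, Real.rpow_def_of_pos (Real.sigmoid_pos _), mul_comm]
    simpa using (hexp.mul hg.tendsto_atBot).const_mul (c / d)
  · have hb := continuousOn_powerSum hgs
    obtain ⟨K, hK⟩ := (isCompact_closedBall (0 : ℂ) 1).exists_bound_of_continuousOn hb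
    have hK0 : 0 ≤ K := (norm_nonneg _).trans (hK 0 (by simp))
    refine ⟨‖c / d‖ * (1 * K), fun y _ => ?_⟩
    rw [norm_mul, norm_mul]
    refine mul_le_mul_of_nonneg_left (mul_le_mul ?_
      (hK _ (by simpa using (norm_sigmoid_lt_one y).le)) (norm_nonneg _) zero_le_one)
      (norm_nonneg _)
    rw [Complex.exp_add, norm_mul, hnorm, one_mul, norm_exp, hL_def, re_mul_ofReal, hdre,
      Real.exp_le_one_iff]
    have := Real.log_nonpos (Real.sigmoid_nonneg (2 * y)) (Real.sigmoid_le_one _)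
    linarith
  · simp_rw [hRexp]
    have h1 := tendsto_powerSum_atTop hgs
    rw [hg_def, tsum_hyperCoeff (by simp; linarith) hsum] at h1
    have h2 := (((hLtop.const_mul d).cexp).mul h1).const_mul (c / d)
    rw [mul_zero, Complex.exp_zero, one_mul] at h2
    have e1 : d + 1 - (d - I * c) - (d + I * c) = 1 - d := by ring
    have e2 : d + 1 - (d - I * c) = 1 + I * c := by ring
    have e3 : d + 1 - (d + I * c) = 1 - I * c := by ring
    rw [e1, e2, e3, reflection_eq c κ hκ] at h2
    exact h2

/-! ### Wronskians, Jost solutions and uniqueness of the scattering data -/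

lemma isSolution_iff {c : ℂ} {q : ℝ → ℂ} {k : ℂ} {ψ : ℝ → Fin 2 → ℂ} :
    IsSolution c q k ψ ↔ ∀ x : ℝ,
      HasDerivAt (fun x => ψ x 0) (-(I * k) * ψ x 0 + c * q x * ψ x 1) x ∧
      HasDerivAt (fun x => ψ x 1) (I * k * ψ x 1 + c * conj (q x) * ψ x 0) x := by
  refine forall_congr' fun x => ?_
  rw [hasDerivAt_pi, Fin.forall_fin_two]
  simp [Matrix.mulVec, dotProduct, Fin.sum_univ_two, sigma3, potential, add_comm]

/-- The Wronskian determinant of two vector functions. -/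
def wronskian (φ ψ : ℝ → Fin 2 → ℂ) (x : ℝ) : ℂ := φ x 0 * ψ x 1 - φ x 1 * ψ x 0

lemma wronskian_swap (φ ψ : ℝ → Fin 2 → ℂ) (x : ℝ) : wronskian φ ψ x = -wronskian ψ φ x := by
  simp only [wronskian]
  ring

lemma IsSolution.wronskian_eq {c : ℂ} {q : ℝ → ℂ} {k : ℂ} {φ ψ : ℝ → Fin 2 → ℂ}
    (hφ : IsSolution c q k φ) (hψ : IsSolution c q k ψ) (x y : ℝ) :
    wronskian φ ψ x = wronskian φ ψ y := by
  rw [isSolution_iff] at hφ hψ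
  have h : ∀ x, HasDerivAt (wronskian φ ψ) 0 x := fun x => by
    refine (((hφ x).1.mul (hψ x).2).sub ((hφ x).2.mul (hψ x).1)).congr_deriv ?_
    ring
  exact is_const_of_deriv_eq_zero (fun x => (h x).differentiableAt) (fun x => (h x).deriv) x y

lemma IsSolution.wronskian_eq_of_tendsto {c : ℂ} {q : ℝ → ℂ} {k : ℂ} {φ ψ : ℝ → Fin 2 → ℂ}
    (hφ : IsSolution c q k φ) (hψ : IsSolution c q k ψ) {l : Filter ℝ} [l.NeBot] {w : ℂ}
    (h : Tendsto (wronskian φ ψ) l (𝓝 w)) (x : ℝ) : wronskian φ ψ x = w :=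
  tendsto_nhds_unique (tendsto_const_nhds.congr fun y => hφ.wronskian_eq hψ x y) h

/-- Two solutions with the same recessive asymptotics are interchangeable in Wronskians. -/
lemma IsSolution.wronskian_congr {c : ℂ} {q : ℝ → ℂ} {k : ℂ} {φ φ' ψ : ℝ → Fin 2 → ℂ}
    (hφ : IsSolution c q k φ) (hφ' : IsSolution c q k φ') (hψ : IsSolution c q k ψ)
    {l : Filter ℝ} [l.NeBot] {e : ℝ → ℂ} {v : Fin 2 → ℂ} (hv : v ≠ 0)
    (he : ∀ᶠ x in l, 1 ≤ ‖e x‖) (h : Tendsto (fun x => e x • φ x) l (𝓝 v))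
    (h' : Tendsto (fun x => e x • φ' x) l (𝓝 v)) (x : ℝ) :
    wronskian φ' ψ x = wronskian φ ψ x := by
  have hc := tendsto_pi_nhds.1 h
  have hc' := tendsto_pi_nhds.1 h'
  -- `e² W(φ', φ)` tends to `0` while `W(φ', φ)` is constant and `|e| ≥ 1` eventually.
  have h0 : wronskian φ' φ x = 0 := by
    have h1 : Tendsto (fun y => e y ^ 2 * wronskian φ' φ x) l (𝓝 0) := by
      have h2 := ((hc' 0).mul (hc 1)).sub ((hc' 1).mul (hc 0))
      have h3 : v 0 * v 1 - v 1 * v 0 = 0 := by ring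
      rw [h3] at h2
      refine h2.congr fun y => ?_
      rw [hφ'.wronskian_eq hφ x y, wronskian]
      simp only [Pi.smul_apply, smul_eq_mul]
      ring
    have h2 : Tendsto (fun _ : ℝ => wronskian φ' φ x) l (𝓝 0) := by
      refine squeeze_zero_norm' ?_ (tendsto_zero_iff_norm_tendsto_zero.1 h1)
      filter_upwards [he] with y hy
      rw [norm_mul, norm_pow]
      exact le_mul_of_one_le_left (norm_nonneg _) (one_le_pow₀ hy)
    exact tendsto_nhds_unique tendsto_const_nhds h2
  -- By the Plücker identity, `W(φ', φ) = 0` gives `W(φ', ψ) φ_i = W(φ, ψ) φ'_i`. Multiplying by `e`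
  -- and passing to the limit replaces both components by `v i`.
  have hpl : ∀ i, wronskian φ' ψ x * v i = wronskian φ ψ x * v i := by
    intro i
    refine tendsto_nhds_unique ((hc i).const_mul (wronskian φ' ψ x))
      (((hc' i).const_mul (wronskian φ ψ x)).congr fun y => ?_)
    have h2 : wronskian φ' φ y = 0 := by rw [hφ'.wronskian_eq hφ y x, h0]
    rw [hφ'.wronskian_eq hψ x y, hφ.wronskian_eq hψ x y]
    simp only [wronskian, Pi.smul_apply, smul_eq_mul] at h2 ⊢
    fin_cases i
    · simp only [Fin.zero_eta]
      linear_combination (-e y * ψ y 0) * h2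
    · simp only [Fin.mk_one]
      linear_combination (-e y * ψ y 1) * h2
  obtain ⟨i, hi⟩ := Function.ne_iff.1 hv
  exact mul_right_cancel₀ hi (hpl i)

lemma eventually_one_le_norm_exp_atBot {k : ℂ} (hk : 0 ≤ k.im) :
    ∀ᶠ x : ℝ in atBot, 1 ≤ ‖Complex.exp (I * k * x)‖ := by
  filter_upwards [eventually_le_atBot 0] with x hx
  rw [norm_exp, Real.one_le_exp_iff]
  simpa using mul_nonpos_of_nonneg_of_nonpos hk hx

lemma eventually_one_le_norm_exp_atTop {k : ℂ} (hk : 0 ≤ k.im) :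
    ∀ᶠ x : ℝ in atTop, 1 ≤ ‖Complex.exp (-(I * k * x))‖ := by
  filter_upwards [eventually_ge_atTop 0] with x hx
  rw [norm_exp, Real.one_le_exp_iff]
  simpa using mul_nonneg hk hx

lemma vecCons_one_zero_ne_zero : (![1, 0] : Fin 2 → ℂ) ≠ 0 := fun h => by
  simpa using congrFun h 0

lemma vecCons_zero_one_ne_zero : (![0, 1] : Fin 2 → ℂ) ≠ 0 := fun h => by
  simpa using congrFun h 1

/-- For `Im k ≥ 0` both normalising exponentials have modulus at least `1` at their own end, so each
of the two solutions can be exchanged in turn without changing the Wronskian. -/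
lemma IsUpperCoefficient.unique {c : ℂ} {q : ℝ → ℂ} {k a a' : ℂ} (hk : 0 ≤ k.im)
    (h : IsUpperCoefficient c q k a) (h' : IsUpperCoefficient c q k a') : a = a' := by
  obtain ⟨m, p, hm, hp, hml, hpl, hd⟩ := h
  obtain ⟨m', p', hm', hp', hml', hpl', hd'⟩ := h'
  have e : wronskian m p 0 = a := by
    rw [← hd 0, Matrix.det_fin_two_of, wronskian]
    ring
  have e' : wronskian m' p' 0 = a' := by
    rw [← hd' 0, Matrix.det_fin_two_of, wronskian]
    ring
  rw [← e, ← e', hm.wronskian_congr hm' hp' vecCons_one_zero_ne_zero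
    (eventually_one_le_norm_exp_atBot hk) hml hml', wronskian_swap, wronskian_swap m p',
    hp.wronskian_congr hp' hm vecCons_zero_one_ne_zero
    (eventually_one_le_norm_exp_atTop hk) hpl hpl']

lemma inv_freeSolution (k : ℂ) (x : ℝ) :
    (freeSolution k x)⁻¹ =
      !![Complex.exp (I * k * x), 0; 0, Complex.exp (-(I * k * x))] := by
  refine Matrix.inv_eq_right_inv ?_
  ext i j
  fin_cases i <;> fin_cases j <;>
    simp [freeSolution, Matrix.mul_apply, Fin.sum_univ_two, ← Complex.exp_add]

lemma norm_exp_I_mul_mul (k x : ℝ) : ‖Complex.exp (I * k * x)‖ = 1 := by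
  rw [norm_exp]
  simp

lemma norm_exp_neg_I_mul_mul (k x : ℝ) : ‖Complex.exp (-(I * k * x))‖ = 1 := by
  rw [norm_exp]
  simp

/-- Multiplying by `E⁻¹` puts exponentials on rows, while the column normalisation puts them on
columns. The two differ only off the diagonal, where the limit is `0` and a unimodular factor is
harmless. -/
lemma tendsto_unimodular_mul_iff {l : Filter ℝ} {e e' f : ℝ → ℂ} (he : ∀ x, ‖e x‖ = 1)
    (he' : ∀ x, ‖e' x‖ = 1) :
    Tendsto (fun x => e x * f x) l (𝓝 0) ↔ Tendsto (fun x => e' x * f x) l (𝓝 0) := by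
  rw [tendsto_zero_iff_norm_tendsto_zero,
    tendsto_zero_iff_norm_tendsto_zero (f := fun x => e' x * f x)]
  simp [he, he']

lemma tendsto_matrix_iff {l : Filter ℝ} {M : ℝ → Matrix (Fin 2) (Fin 2) ℂ}
    {N : Matrix (Fin 2) (Fin 2) ℂ} :
    Tendsto M l (𝓝 N) ↔ ∀ i j, Tendsto (fun x => M x i j) l (𝓝 (N i j)) :=
  tendsto_pi_nhds.trans (forall_congr' fun _ => tendsto_pi_nhds)

/-- For a real spectral parameter the Jost property can be read off column by column. -/
lemma isJost_iff {c : ℂ} {q : ℝ → ℂ} {k : ℝ} {l : Filter ℝ}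
    {Ψ : ℝ → Matrix (Fin 2) (Fin 2) ℂ} :
    IsJost c q k l Ψ ↔ (IsSolution c q k (fun x i => Ψ x i 0) ∧
        IsSolution c q k (fun x i => Ψ x i 1)) ∧
      Tendsto (fun x : ℝ => Complex.exp (I * k * x) • fun i => Ψ x i 0) l (𝓝 ![1, 0]) ∧
      Tendsto (fun x : ℝ => Complex.exp (-(I * k * x)) • fun i => Ψ x i 1) l (𝓝 ![0, 1]) := by
  rw [IsJost, Fin.forall_fin_two]
  refine and_congr_right fun _ => ?_
  simp_rw [inv_freeSolution]
  rw [tendsto_matrix_iff, tendsto_pi_nhds, tendsto_pi_nhds]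
  simp_rw [Fin.forall_fin_two]
  simp only [Matrix.mul_apply, Fin.sum_univ_two, Matrix.of_apply, Matrix.cons_val',
    Matrix.cons_val_zero,
    Matrix.cons_val_one, Matrix.cons_val_fin_one, zero_mul, add_zero, zero_add,
    Pi.smul_apply, smul_eq_mul,
    Matrix.one_apply, if_true, zero_ne_one, one_ne_zero, if_false]
  have h1 := tendsto_unimodular_mul_iff (l := l) (f := fun x => Ψ x 1 0) (norm_exp_I_mul_mul k)
    (norm_exp_neg_I_mul_mul k)
  have h2 := tendsto_unimodular_mul_iff (l := l) (f := fun x => Ψ x 0 1) (norm_exp_I_mul_mul k)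
    (norm_exp_neg_I_mul_mul k)
  rw [h1, h2]
  tauto

lemma IsJost.wronskian_eq_one {c : ℂ} {q : ℝ → ℂ} {k : ℝ} {l : Filter ℝ} [l.NeBot]
    {Ψ : ℝ → Matrix (Fin 2) (Fin 2) ℂ} (h : IsJost c q k l Ψ) (x : ℝ) :
    wronskian (fun x i => Ψ x i 0) (fun x i => Ψ x i 1) x = 1 := by
  obtain ⟨⟨h0, h1⟩, hl0, hl1⟩ := isJost_iff.1 h
  refine h0.wronskian_eq_of_tendsto h1 (l := l) ?_ x
  have hc0 := tendsto_pi_nhds.1 hl0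
  have hc1 := tendsto_pi_nhds.1 hl1
  have ht := ((hc0 0).mul (hc1 1)).sub ((hc0 1).mul (hc1 0))
  simp only [Matrix.cons_val_zero, Matrix.cons_val_one, mul_one, mul_zero, sub_zero,
    Matrix.cons_val_fin_one] at ht
  refine ht.congr fun y => ?_
  have : Complex.exp (I * k * y) * Complex.exp (-(I * k * y)) = 1 := by
    rw [← Complex.exp_add]; simp
  simp only [wronskian, Pi.smul_apply, smul_eq_mul]
  linear_combination (Ψ y 0 0 * Ψ y 1 1 - Ψ y 1 0 * Ψ y 0 1) * this

/-- The entries `S₂₂` and `S₁₂` as Wronskians of Jost solutions. -/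
lemma scattering_entries {c : ℂ} {q : ℝ → ℂ} {k : ℝ} {Ψp Ψm : ℝ → Matrix (Fin 2) (Fin 2) ℂ}
    (hm : IsJost c q k atBot Ψm) {S : Matrix (Fin 2) (Fin 2) ℂ} (hS : ∀ x, Ψp x = Ψm x * S) :
    S 1 1 = wronskian (fun x i => Ψm x i 0) (fun x i => Ψp x i 1) 0 ∧
      S 0 1 = wronskian (fun x i => Ψp x i 1) (fun x i => Ψm x i 1) 0 := by
  have h1 := hm.wronskian_eq_one 0
  simp only [wronskian, hS, Matrix.mul_apply, Fin.sum_univ_two] at h1 ⊢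
  constructor
  · linear_combination (-S 1 1) * h1
  · linear_combination (-S 0 1) * h1

/-- Wronskians of Jost solutions at a real spectral parameter do not depend on the choice of the
Jost solutions. -/
lemma IsScatteringMatrix.entries_eq {c : ℂ} {q : ℝ → ℂ} {k : ℝ}
    {Ψp Ψm : ℝ → Matrix (Fin 2) (Fin 2) ℂ} (hp : IsJost c q k atTop Ψp)
    (hm : IsJost c q k atBot Ψm) {S : Matrix (Fin 2) (Fin 2) ℂ}
    (hS : IsScatteringMatrix c q k S) :
    S 1 1 = wronskian (fun x i => Ψm x i 0) (fun x i => Ψp x i 1) 0 ∧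
      S 0 1 = wronskian (fun x i => Ψp x i 1) (fun x i => Ψm x i 1) 0 := by
  obtain ⟨Ψp', Ψm', hp', hm', hSS⟩ := hS
  obtain ⟨h1, h2⟩ := scattering_entries hm' hSS
  obtain ⟨⟨hs0, hs1⟩, hl0, hl1⟩ := isJost_iff.1 hm
  obtain ⟨⟨hs0', hs1'⟩, hl0', hl1'⟩ := isJost_iff.1 hm'
  obtain ⟨⟨-, ht1⟩, -, hr1⟩ := isJost_iff.1 hp
  obtain ⟨⟨-, ht1'⟩, -, hr1'⟩ := isJost_iff.1 hp'
  have he : ∀ (l : Filter ℝ), ∀ᶠ x : ℝ in l, 1 ≤ ‖Complex.exp (I * k * x)‖ := fun l =>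
    .of_forall fun x => (norm_exp_I_mul_mul k x).ge
  have he' : ∀ (l : Filter ℝ), ∀ᶠ x : ℝ in l, 1 ≤ ‖Complex.exp (-(I * k * x))‖ := fun l =>
    .of_forall fun x => (norm_exp_neg_I_mul_mul k x).ge
  have e1 := hs0.wronskian_congr hs0' ht1' vecCons_one_zero_ne_zero (he _) hl0 hl0' 0
  have e2 := ht1.wronskian_congr ht1' hs0 vecCons_zero_one_ne_zero (he' _) hr1 hr1' 0
  have e3 := ht1.wronskian_congr ht1' hs1' vecCons_zero_one_ne_zero (he' _) hr1 hr1' 0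
  have e4 := hs1.wronskian_congr hs1' ht1 vecCons_zero_one_ne_zero (he' _) hl1 hl1' 0
  rw [h1, h2, e1, e3]
  constructor
  · rw [wronskian_swap, e2, ← wronskian_swap]
  · rw [wronskian_swap, e4, ← wronskian_swap]

/-- Cramer's rule with `det Ψ⁻ = 1`; the entries are constant because they are Wronskians of
solutions. -/
lemma exists_isScatteringMatrix {c : ℂ} {q : ℝ → ℂ} {k : ℝ}
    {Ψp Ψm : ℝ → Matrix (Fin 2) (Fin 2) ℂ} (hp : IsJost c q k atTop Ψp)
    (hm : IsJost c q k atBot Ψm) : ∃ S, IsScatteringMatrix c q k S := by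
  obtain ⟨⟨hs0, hs1⟩, -⟩ := isJost_iff.1 hm
  obtain ⟨⟨ht0, ht1⟩, -⟩ := isJost_iff.1 hp
  set m0 := fun (x : ℝ) (i : Fin 2) => Ψm x i 0
  set m1 := fun (x : ℝ) (i : Fin 2) => Ψm x i 1
  set p0 := fun (x : ℝ) (i : Fin 2) => Ψp x i 0
  set p1 := fun (x : ℝ) (i : Fin 2) => Ψp x i 1
  refine ⟨!![wronskian p0 m1 0, wronskian p1 m1 0; wronskian m0 p0 0, wronskian m0 p1 0],
    Ψp, Ψm, hp, hm, fun x => ?_⟩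
  have h1 : wronskian m0 m1 x = 1 := hm.wronskian_eq_one x
  rw [ht0.wronskian_eq hs1 0 x, ht1.wronskian_eq hs1 0 x, hs0.wronskian_eq ht0 0 x,
    hs0.wronskian_eq ht1 0 x]
  ext i j
  simp only [wronskian, m0, m1, p0, p1] at h1 ⊢
  fin_cases i <;> fin_cases j <;> simp [Matrix.mul_apply, Fin.sum_univ_two]
  · linear_combination (-Ψp x 0 0) * h1
  · linear_combination (-Ψp x 0 1) * h1
  · linear_combination (-Ψp x 1 0) * h1
  · linear_combination (-Ψp x 1 1) * h1

/-! ### Jost solutions of the soliton potential built from amplitudes -/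

/-- The phase `e^{i (V x + φ₀)}` of the soliton. -/
def phase (V φ₀ x : ℝ) : ℂ := Complex.exp (I * ((V : ℂ) * x + φ₀))

lemma norm_phase (V φ₀ x : ℝ) : ‖phase V φ₀ x‖ = 1 := by
  rw [phase, norm_exp]
  simp

lemma conj_phase (V φ₀ x : ℝ) : conj (phase V φ₀ x) = (phase V φ₀ x)⁻¹ := by
  rw [phase, ← exp_conj, ← Complex.exp_neg]
  simp

lemma phase_ne_zero (V φ₀ x : ℝ) : phase V φ₀ x ≠ 0 := Complex.exp_ne_zero _

lemma hasDerivAt_phase (V φ₀ x : ℝ) :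
    HasDerivAt (phase V φ₀) (I * V * phase V φ₀ x) x := by
  have hx : HasDerivAt (fun x : ℝ => (x : ℂ)) 1 x := (hasDerivAt_id x).ofReal_comp
  refine ((((hx.const_mul (V : ℂ)).add_const (φ₀ : ℂ)).const_mul I).cexp).congr_deriv ?_
  rw [phase]
  ring

lemma soliton_eq (A V φ₀ x₀ x : ℝ) :
    soliton A V φ₀ x₀ x = A * phase V φ₀ x / Complex.cosh ((A * (x - x₀) : ℝ) : ℂ) := by
  simp [soliton, phase]

lemma conj_soliton (A V φ₀ x₀ x : ℝ) :
    conj (soliton A V φ₀ x₀ x) =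
      A * (phase V φ₀ x)⁻¹ / Complex.cosh ((A * (x - x₀) : ℝ) : ℂ) := by
  rw [soliton_eq, map_div₀, map_mul, conj_phase, conj_ofReal, ← ofReal_cosh, conj_ofReal]

/-- As `cosh` is even, reflection turns an amplitude normalised at `-∞` into one normalised at `+∞`,
at the price of `κ ↦ -κ`. -/
lemma IsAmplitude.comp_neg {c κ : ℂ} {U R : ℝ → ℂ} (h : IsAmplitude c κ U R) :
    IsAmplitude c (-κ) (fun y => U (-y)) (fun y => -R (-y)) := by
  intro y
  have h1 := (h (-y)).1.scomp y (hasDerivAt_neg y)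
  have h2 := ((h (-y)).2.scomp y (hasDerivAt_neg y)).neg
  refine ⟨h1.congr_deriv ?_, h2.congr_deriv ?_⟩
  · simp only [ofReal_neg, Complex.cosh_neg, neg_smul, one_smul]
    ring
  · simp only [ofReal_neg, Complex.cosh_neg, neg_smul, one_smul]
    ring

lemma hasDerivAt_comp_affine {A x₀ x : ℝ} {f : ℝ → ℂ} {f' : ℂ}
    (h : HasDerivAt f f' (A * (x - x₀))) :
    HasDerivAt (fun x => f (A * (x - x₀))) (A * f') x := by
  have h1 : HasDerivAt (fun x => A * (x - x₀)) A x := by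
    simpa using ((hasDerivAt_id x).sub_const x₀).const_mul A
  exact (h.scomp x h1).congr_deriv (by simp)

lemma hasDerivAt_exp_I_mul (k : ℂ) (x : ℝ) :
    HasDerivAt (fun x : ℝ => Complex.exp (I * k * x)) (I * k * Complex.exp (I * k * x)) x := by
  have hx : HasDerivAt (fun x : ℝ => (x : ℂ)) 1 x := (hasDerivAt_id x).ofReal_comp
  refine ((hx.const_mul (I * k)).cexp).congr_deriv ?_
  ring

lemma hasDerivAt_exp_neg_I_mul (k : ℂ) (x : ℝ) :
    HasDerivAt (fun x : ℝ => Complex.exp (-(I * k * x)))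
      (-(I * k) * Complex.exp (-(I * k * x))) x := by
  have hx : HasDerivAt (fun x : ℝ => (x : ℂ)) 1 x := (hasDerivAt_id x).ofReal_comp
  refine ((hx.const_mul (I * k)).neg.cexp).congr_deriv ?_
  simp only [Pi.neg_apply]
  ring

/-- The solution with factor `e^{-ikx}` built from an amplitude. -/
def incoming (A V φ₀ x₀ : ℝ) (k : ℂ) (U R : ℝ → ℂ) (x : ℝ) : Fin 2 → ℂ :=
  ![Complex.exp (-(I * k * x)) * U (A * (x - x₀)),
    Complex.exp (-(I * k * x)) * ((phase V φ₀ x)⁻¹ * R (A * (x - x₀)))]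

/-- The solution with factor `e^{ikx}` built from an amplitude. -/
def outgoing (A V φ₀ x₀ : ℝ) (k : ℂ) (U R : ℝ → ℂ) (x : ℝ) : Fin 2 → ℂ :=
  ![Complex.exp (I * k * x) * (phase V φ₀ x * R (A * (x - x₀))),
    Complex.exp (I * k * x) * U (A * (x - x₀))]

/-- Differentiating the removed phase contributes `iV` to the second component, which is the shift
of `k` by `V/2`; the rescaling contributes the factor `A`. -/
lemma IsAmplitude.isSolution_incoming {A V φ₀ x₀ : ℝ} {c k κ : ℂ} (hk : A * κ = k + V / 2)
    {U R : ℝ → ℂ} (h : IsAmplitude c κ U R) :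
    IsSolution c (soliton A V φ₀ x₀) k (incoming A V φ₀ x₀ k U R) := by
  rw [isSolution_iff]
  intro x
  have hU := hasDerivAt_comp_affine (h (A * (x - x₀))).1
  have hR := hasDerivAt_comp_affine (h (A * (x - x₀))).2
  have he := hasDerivAt_exp_neg_I_mul k x
  have hp := phase_ne_zero V φ₀ x
  have hch := cosh_ofReal_ne_zero (A * (x - x₀))
  simp only [incoming, Matrix.cons_val_zero, Matrix.cons_val_one, Matrix.cons_val_fin_one]
  rw [conj_soliton, soliton_eq]
  constructor
  · refine (he.mul hU).congr_deriv ?_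
    field_simp
  · refine (he.mul (((hasDerivAt_phase V φ₀ x).inv hp).mul hR)).congr_deriv ?_
    simp only [Pi.mul_apply, Pi.inv_apply]
    field_simp
    linear_combination (2 * I * Complex.cosh ((A * (x - x₀) : ℝ) : ℂ) * R (A * (x - x₀))) * hk

lemma IsAmplitude.isSolution_outgoing {A V φ₀ x₀ : ℝ} {c k κ : ℂ} (hk : A * κ = -(k + V / 2))
    {U R : ℝ → ℂ} (h : IsAmplitude c κ U R) :
    IsSolution c (soliton A V φ₀ x₀) k (outgoing A V φ₀ x₀ k U R) := by
  rw [isSolution_iff]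
  intro x
  have hU := hasDerivAt_comp_affine (h (A * (x - x₀))).1
  have hR := hasDerivAt_comp_affine (h (A * (x - x₀))).2
  have he := hasDerivAt_exp_I_mul k x
  have hp := phase_ne_zero V φ₀ x
  have hch := cosh_ofReal_ne_zero (A * (x - x₀))
  simp only [outgoing, Matrix.cons_val_zero, Matrix.cons_val_one, Matrix.cons_val_fin_one]
  rw [conj_soliton, soliton_eq]
  constructor
  · refine (he.mul ((hasDerivAt_phase V φ₀ x).mul hR)).congr_deriv ?_
    simp only [Pi.mul_apply]
    field_simp
    linear_combination (2 * I * Complex.cosh ((A * (x - x₀) : ℝ) : ℂ) * R (A * (x - x₀))) * hk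
  · refine (he.mul hU).congr_deriv ?_
    field_simp

lemma tendsto_affine_atTop {A : ℝ} (hA : 0 < A) (x₀ : ℝ) :
    Tendsto (fun x => A * (x - x₀)) atTop atTop :=
  (tendsto_atTop_add_const_right atTop (-x₀) tendsto_id).const_mul_atTop hA

lemma tendsto_affine_atBot {A : ℝ} (hA : 0 < A) (x₀ : ℝ) :
    Tendsto (fun x => A * (x - x₀)) atBot atBot :=
  (tendsto_atBot_add_const_right atBot (-x₀) tendsto_id).const_mul_atBot hA

lemma tendsto_unimodular_mul {α : Type*} {l : Filter α} {e f : α → ℂ} (he : ∀ x, ‖e x‖ = 1)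
    (hf : Tendsto f l (𝓝 0)) : Tendsto (fun x => e x * f x) l (𝓝 0) := by
  rw [tendsto_zero_iff_norm_tendsto_zero] at hf ⊢
  simpa [he] using hf

lemma tendsto_incoming {A V φ₀ x₀ : ℝ} {k : ℂ} {U R : ℝ → ℂ} {l : Filter ℝ}
    (hU : Tendsto (fun x => U (A * (x - x₀))) l (𝓝 1))
    (hR : Tendsto (fun x => R (A * (x - x₀))) l (𝓝 0)) :
    Tendsto (fun x : ℝ => Complex.exp (I * k * x) • incoming A V φ₀ x₀ k U R x) l
      (𝓝 ![1, 0]) := by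
  have he : ∀ x : ℝ, Complex.exp (I * k * x) * Complex.exp (-(I * k * x)) = 1 := fun x => by
    rw [← Complex.exp_add]; simp
  rw [tendsto_pi_nhds, Fin.forall_fin_two]
  simp only [incoming, Pi.smul_apply, smul_eq_mul, Matrix.cons_val_zero, Matrix.cons_val_one,
    Matrix.cons_val_fin_one, ← mul_assoc, he, one_mul]
  exact ⟨hU, tendsto_unimodular_mul (fun x => by rw [norm_inv, norm_phase, inv_one]) hR⟩

lemma tendsto_outgoing {A V φ₀ x₀ : ℝ} {k : ℂ} {U R : ℝ → ℂ} {l : Filter ℝ}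
    (hU : Tendsto (fun x => U (A * (x - x₀))) l (𝓝 1))
    (hR : Tendsto (fun x => R (A * (x - x₀))) l (𝓝 0)) :
    Tendsto (fun x : ℝ => Complex.exp (-(I * k * x)) • outgoing A V φ₀ x₀ k U R x) l
      (𝓝 ![0, 1]) := by
  have he : ∀ x : ℝ, Complex.exp (-(I * k * x)) * Complex.exp (I * k * x) = 1 := fun x => by
    rw [← Complex.exp_add]; simp
  rw [tendsto_pi_nhds, Fin.forall_fin_two]
  simp only [outgoing, Pi.smul_apply, smul_eq_mul, Matrix.cons_val_zero, Matrix.cons_val_one,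
    Matrix.cons_val_fin_one, ← mul_assoc, he, one_mul]
  exact ⟨tendsto_unimodular_mul (norm_phase V φ₀) hR, hU⟩

lemma tendsto_mul_zero_of_bounded {f g : ℝ → ℂ} (hf : ∃ K, ∀ y, 0 ≤ y → ‖f y‖ ≤ K)
    (hg : Tendsto g atTop (𝓝 0)) : Tendsto (fun y => f y * g y) atTop (𝓝 0) := by
  obtain ⟨K, hK⟩ := hf
  have h1 : Tendsto (fun y => K * ‖g y‖) atTop (𝓝 0) := by
    simpa using hg.norm.const_mul K
  refine squeeze_zero_norm' ?_ h1
  filter_upwards [eventually_ge_atTop 0] with y hy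
  rw [norm_mul]
  exact mul_le_mul_of_nonneg_right (hK y hy) (norm_nonneg _)

/-- The Wronskian of the two recessive solutions is the transmission coefficient. -/
lemma wronskian_incoming_outgoing {A : ℝ} (hA : 0 < A) {V φ₀ x₀ : ℝ} {c k κ a : ℂ}
    (hk : A * κ = k + V / 2) {U R : ℝ → ℂ} (h : IsAmplitude c κ U R)
    (hU : Tendsto U atBot (𝓝 1)) (hR : Tendsto R atBot (𝓝 0)) (ha : Tendsto U atTop (𝓝 a))
    (hRb : ∃ K, ∀ y, 0 ≤ y → ‖R y‖ ≤ K) (x : ℝ) :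
    wronskian (incoming A V φ₀ x₀ k U R)
      (outgoing A V φ₀ x₀ k (fun y => U (-y)) (fun y => -R (-y))) x = a := by
  have hs1 := h.isSolution_incoming (φ₀ := φ₀) (x₀ := x₀) hk
  have hs2 := h.comp_neg.isSolution_outgoing (A := A) (V := V) (φ₀ := φ₀) (x₀ := x₀) (k := k)
    (by rw [mul_neg, hk])
  refine hs1.wronskian_eq_of_tendsto hs2 (l := atTop) ?_ x
  -- In the Wronskian the exponentials and phases cancel. At `+∞` the reflected amplitudes tend to
  -- `1` and `0`, so boundedness of `R` suffices.
  have h1 : Tendsto (fun y => U y * U (-y) + R y * R (-y)) atTop (𝓝 (a * 1 + 0)) :=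
    (ha.mul (hU.comp tendsto_neg_atTop_atBot)).add
      (tendsto_mul_zero_of_bounded hRb (hR.comp tendsto_neg_atTop_atBot))
  rw [mul_one, add_zero] at h1
  refine (h1.comp (tendsto_affine_atTop hA x₀)).congr fun x => ?_
  have he : Complex.exp (-(I * k * x)) * Complex.exp (I * k * x) = 1 := by
    rw [← Complex.exp_add]; simp
  have hp := mul_inv_cancel₀ (phase_ne_zero V φ₀ x)
  simp only [Function.comp, wronskian, incoming, outgoing, Matrix.cons_val_zero,
    Matrix.cons_val_one, Matrix.cons_val_fin_one]
  generalize U (A * (x - x₀)) = u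
  generalize R (A * (x - x₀)) = r
  generalize U (-(A * (x - x₀))) = u'
  generalize R (-(A * (x - x₀))) = r'
  linear_combination (-u * u' - r * r') * he -
    (Complex.exp (-(I * k * x)) * Complex.exp (I * k * x) * r * r') * hp

/-- The Wronskian that gives the reflection coefficient. -/
lemma wronskian_outgoing_outgoing {A : ℝ} (hA : 0 < A) {V φ₀ x₀ k : ℝ} {c κ b : ℂ}
    (hk : A * κ = k + V / 2) {U R U' R' : ℝ → ℂ} (h : IsAmplitude c κ U R)
    (hU : Tendsto U atBot (𝓝 1)) (hR : Tendsto R atBot (𝓝 0)) (h' : IsAmplitude c (-κ) U' R')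
    (hUb : ∃ K, ∀ y, 0 ≤ y → ‖U' y‖ ≤ K)
    (hb : Tendsto (fun y : ℝ => Complex.exp (-(2 * I * -κ * y)) * R' y) atTop (𝓝 b)) (x : ℝ) :
    wronskian (outgoing A V φ₀ x₀ k (fun y => U (-y)) (fun y => -R (-y)))
      (outgoing A V φ₀ x₀ k U' R') x = -(Complex.exp (I * (φ₀ + (2 * k + V) * x₀)) * b) := by
  have hs1 := h.comp_neg.isSolution_outgoing (A := A) (V := V) (φ₀ := φ₀) (x₀ := x₀) (k := k)
    (by rw [mul_neg, hk])
  have hs2 := h'.isSolution_outgoing (A := A) (V := V) (φ₀ := φ₀) (x₀ := x₀) (k := k)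
    (by rw [mul_neg, hk])
  refine hs1.wronskian_eq_of_tendsto hs2 (l := atTop) ?_ x
  have h1 := tendsto_mul_zero_of_bounded hUb (hR.comp tendsto_neg_atTop_atBot)
  have h2 := ((hU.comp tendsto_neg_atTop_atBot).mul hb).const_mul
    (Complex.exp (I * (φ₀ + (2 * k + V) * x₀)))
  rw [one_mul] at h2
  have h3 : Tendsto (fun x : ℝ => Complex.exp (I * k * x) * Complex.exp (I * k * x) *
      phase V φ₀ x * (U' (A * (x - x₀)) * R (-(A * (x - x₀))))) atTop (𝓝 0) :=
    tendsto_unimodular_mul (fun x => by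
      rw [norm_mul, norm_mul, norm_exp_I_mul_mul, norm_phase]; norm_num)
      (h1.comp (tendsto_affine_atTop hA x₀))
  have h4 := (h3.add (h2.comp (tendsto_affine_atTop hA x₀))).neg
  rw [zero_add] at h4
  refine h4.congr fun x => ?_
  -- The `x`-dependent phases combine into `e^{2iκy}`; recentring `y` at `x₀` leaves the constant
  -- phase `e^{i(φ₀+(2k+V)x₀)}`.
  have he : Complex.exp (I * (φ₀ + (2 * k + V) * x₀)) *
      Complex.exp (-(2 * I * -κ * ((A * (x - x₀) : ℝ) : ℂ))) =
      Complex.exp (I * k * x) * Complex.exp (I * k * x) * phase V φ₀ x := by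
    rw [phase, ← Complex.exp_add, ← Complex.exp_add, ← Complex.exp_add]
    congr 1
    push_cast
    linear_combination (2 * I * (x - x₀)) * hk
  simp only [Function.comp, wronskian, outgoing, Matrix.cons_val_zero,
    Matrix.cons_val_one, Matrix.cons_val_fin_one]
  linear_combination (-U (-(A * (x - x₀))) * R' (A * (x - x₀))) * he

lemma isUpperCoefficient_soliton {A : ℝ} (hA : 0 < A) (V φ₀ x₀ : ℝ) (c : ℂ) {k : ℂ}
    (hk : 0 ≤ k.im) :
    IsUpperCoefficient c (soliton A V φ₀ x₀) k (transmission c ((k + V / 2) / A)) := by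
  have hA0 : (A : ℂ) ≠ 0 := by exact_mod_cast hA.ne'
  have hκ : A * ((k + V / 2) / A) = k + V / 2 := by field_simp
  have him : 0 ≤ ((k + V / 2) / A).im := by
    rw [div_ofReal_im]
    have : ((V : ℂ) / 2).im = 0 := by simp
    rw [add_im, this, add_zero]
    positivity
  obtain ⟨U, R, h, hU, hR, ha, hRb⟩ := exists_isAmplitude c him
  refine ⟨_, _, h.isSolution_incoming hκ, h.comp_neg.isSolution_outgoing (by rw [mul_neg, hκ]),
    tendsto_incoming (hU.comp (tendsto_affine_atBot hA x₀))
      (hR.comp (tendsto_affine_atBot hA x₀)),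
    tendsto_outgoing (hU.comp (tendsto_neg_atTop_atBot.comp (tendsto_affine_atTop hA x₀))) ?_,
    fun x => ?_⟩
  · simpa [Function.comp_def] using
      (hR.comp (tendsto_neg_atTop_atBot.comp (tendsto_affine_atTop hA x₀))).neg
  · rw [Matrix.det_fin_two_of, ← wronskian_incoming_outgoing hA hκ h hU hR ha hRb x, wronskian]
    ring

/-- The matrix function with given columns. -/
def ofColumns (φ ψ : ℝ → Fin 2 → ℂ) (x : ℝ) : Matrix (Fin 2) (Fin 2) ℂ :=
  Matrix.of fun i j => ![φ x i, ψ x i] j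

lemma ofColumns_zero (φ ψ : ℝ → Fin 2 → ℂ) : (fun x i => ofColumns φ ψ x i 0) = φ := rfl

lemma ofColumns_one (φ ψ : ℝ → Fin 2 → ℂ) : (fun x i => ofColumns φ ψ x i 1) = ψ := rfl

lemma isJost_ofColumns {c : ℂ} {q : ℝ → ℂ} {k : ℝ} {l : Filter ℝ} {φ ψ : ℝ → Fin 2 → ℂ}
    (hφ : IsSolution c q k φ) (hψ : IsSolution c q k ψ)
    (hφl : Tendsto (fun x : ℝ => Complex.exp (I * k * x) • φ x) l (𝓝 ![1, 0]))
    (hψl : Tendsto (fun x : ℝ => Complex.exp (-(I * k * x)) • ψ x) l (𝓝 ![0, 1])) :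
    IsJost c q k l (ofColumns φ ψ) :=
  isJost_iff.2 ⟨⟨hφ, hψ⟩, hφl, hψl⟩

/-- The amplitude `U` at `κ` gives the first column of `Ψ⁻` and, reflected, the second column of
`Ψ⁺`. The second column of `Ψ⁻` uses the representation at `-κ` that displays the reflection
coefficient. `U₂` only completes `Ψ⁺` and enters neither Wronskian. -/
lemma exists_isJost_soliton {A : ℝ} (hA : 0 < A) (V φ₀ x₀ : ℝ) (c : ℂ) (k : ℝ) :
    ∃ Ψp Ψm : ℝ → Matrix (Fin 2) (Fin 2) ℂ, IsJost c (soliton A V φ₀ x₀) k atTop Ψp ∧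
      IsJost c (soliton A V φ₀ x₀) k atBot Ψm ∧
      wronskian (fun x i => Ψm x i 0) (fun x i => Ψp x i 1) 0 =
        transmission c ((k + V / 2) / A) ∧
      wronskian (fun x i => Ψp x i 1) (fun x i => Ψm x i 1) 0 =
        -(Complex.exp (I * (φ₀ + (2 * k + V) * x₀)) * reflection c ((k + V / 2) / A)) := by
  have hA0 : (A : ℂ) ≠ 0 := by exact_mod_cast hA.ne'
  set κ : ℂ := (k + V / 2) / A with hκ_def
  have hκ : A * κ = k + V / 2 := by rw [hκ_def]; field_simp
  have hκ' : A * -κ = -(k + V / 2) := by rw [mul_neg, hκ]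
  have him : κ.im = 0 := by
    have : κ = (((k + V / 2) / A : ℝ) : ℂ) := by rw [hκ_def]; push_cast; rfl
    rw [this, ofReal_im]
  have him' : (-κ).im = 0 := by rw [neg_im, him, neg_zero]
  obtain ⟨U, R, h, hU, hR, ha, hRb⟩ := exists_isAmplitude c him.ge
  obtain ⟨U₂, R₂, h₂, hU₂, hR₂, -⟩ := exists_isAmplitude c him'.ge
  obtain ⟨U₃, R₃, h₃, hU₃, hR₃, hUb, hb⟩ := exists_isAmplitude_of_im_eq_zero c him'
  have hrefl : reflection c (-κ) = reflection c κ := by simp [reflection]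
  rw [hrefl] at hb
  have hbot := tendsto_affine_atBot hA x₀
  have htop := tendsto_neg_atTop_atBot.comp (tendsto_affine_atTop hA x₀)
  have h2' := h₂.comp_neg
  rw [neg_neg] at h2'
  have hp := isJost_ofColumns (h2'.isSolution_incoming (φ₀ := φ₀) (x₀ := x₀) hκ)
    (h.comp_neg.isSolution_outgoing (φ₀ := φ₀) (x₀ := x₀) hκ')
    (tendsto_incoming (hU₂.comp htop) (by simpa [Function.comp_def] using (hR₂.comp htop).neg))
    (tendsto_outgoing (hU.comp htop) (by simpa [Function.comp_def] using (hR.comp htop).neg))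
  have hm := isJost_ofColumns (h.isSolution_incoming (φ₀ := φ₀) (x₀ := x₀) hκ)
    (h₃.isSolution_outgoing (φ₀ := φ₀) (x₀ := x₀) hκ')
    (tendsto_incoming (hU.comp hbot) (hR.comp hbot))
    (tendsto_outgoing (hU₃.comp hbot) (hR₃.comp hbot))
  refine ⟨_, _, hp, hm, ?_, ?_⟩
  · rw [ofColumns_zero, ofColumns_one]
    exact wronskian_incoming_outgoing hA hκ h hU hR ha hRb 0
  · rw [ofColumns_one, ofColumns_one]
    exact wronskian_outgoing_outgoing hA hκ h hU hR h₃ hUb hb 0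

theorem isScatteringData_soliton_iff {A : ℝ} (hA : 0 < A) (V φ₀ x₀ : ℝ) (c : ℂ)
    (D : ℝ → ℂ × ℂ) :
    IsScatteringData c (soliton A V φ₀ x₀) D ↔ ∀ k : ℝ, D k =
      (transmission c ((k + V / 2) / A),
        -(Complex.exp (I * (φ₀ + (2 * k + V) * x₀)) * reflection c ((k + V / 2) / A))) := by
  refine forall_congr' fun k => ?_
  obtain ⟨Ψp, Ψm, hp, hm, h1, h2⟩ := exists_isJost_soliton hA V φ₀ x₀ c k
  constructor
  · rintro ⟨S, hS, hD⟩
    obtain ⟨e1, e2⟩ := hS.entries_eq hp hm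
    rw [hD, e1, e2, h1, h2]
  · intro hD
    obtain ⟨S, hS⟩ := exists_isScatteringMatrix hp hm
    obtain ⟨e1, e2⟩ := hS.entries_eq hp hm
    exact ⟨S, hS, by rw [hD, e1, e2, h1, h2]⟩

theorem isUpperCoefficient_soliton_iff {A : ℝ} (hA : 0 < A) (V φ₀ x₀ : ℝ) (c : ℂ) {k : ℂ}
    (hk : 0 ≤ k.im) (a : ℂ) :
    IsUpperCoefficient c (soliton A V φ₀ x₀) k a ↔ a = transmission c ((k + V / 2) / A) := by
  have h := isUpperCoefficient_soliton hA V φ₀ x₀ c hk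
  exact ⟨fun ha => ha.unique hk h, fun ha => ha ▸ h⟩

/-! ### The soliton is a Schwartz function -/

lemma hasDerivAt_tanh_comp (A x₀ x : ℝ) :
    HasDerivAt (fun x : ℝ => Complex.tanh ((A * (x - x₀) : ℝ) : ℂ))
      (A * (1 - Complex.tanh ((A * (x - x₀) : ℝ) : ℂ) ^ 2)) x := by
  have hch := cosh_ofReal_ne_zero (A * (x - x₀))
  have h1 := ((Complex.hasDerivAt_sinh ((A * (x - x₀) : ℝ) : ℂ)).div
    (Complex.hasDerivAt_cosh _) hch).comp_ofReal
  have h2 := hasDerivAt_comp_affine (A := A) (x₀ := x₀) (x := x) h1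
  simp only [Complex.tanh_eq_sinh_div_cosh]
  refine h2.congr_deriv ?_
  field_simp

lemma hasDerivAt_soliton (A V φ₀ x₀ x : ℝ) :
    HasDerivAt (soliton A V φ₀ x₀)
      (soliton A V φ₀ x₀ x * (I * V - A * Complex.tanh ((A * (x - x₀) : ℝ) : ℂ))) x := by
  have hch := cosh_ofReal_ne_zero (A * (x - x₀))
  have h1 := (Complex.hasDerivAt_cosh ((A * (x - x₀) : ℝ) : ℂ)).comp_ofReal
  have h2 := hasDerivAt_comp_affine (A := A) (x₀ := x₀) (x := x) h1
  have h3 := ((hasDerivAt_phase V φ₀ x).const_mul (A : ℂ)).div h2 hch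
  have h4 : soliton A V φ₀ x₀ = fun x => A * phase V φ₀ x / Complex.cosh ((A * (x - x₀) : ℝ) : ℂ) :=
    funext fun x => soliton_eq A V φ₀ x₀ x
  rw [h4]
  refine h3.congr_deriv ?_
  rw [Complex.tanh_eq_sinh_div_cosh]
  field_simp

/-- Both `q'/q` and the derivative of `tanh` are polynomials in `tanh`, which is bounded; decay of
every derivative thus reduces to decay of `q`. -/
lemma iteratedDeriv_soliton (A V φ₀ x₀ : ℝ) (n : ℕ) :
    ∃ p : Polynomial ℂ, iteratedDeriv n (soliton A V φ₀ x₀) = fun x =>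
      soliton A V φ₀ x₀ x * p.eval (Complex.tanh ((A * (x - x₀) : ℝ) : ℂ)) := by
  induction n with
  | zero => exact ⟨1, by simp⟩
  | succ n ih =>
    obtain ⟨p, hp⟩ := ih
    refine ⟨(Polynomial.C (I * V) - Polynomial.C (A : ℂ) * Polynomial.X) * p +
      Polynomial.C (A : ℂ) * (1 - Polynomial.X ^ 2) * p.derivative, ?_⟩
    rw [iteratedDeriv_succ, hp]
    funext x
    have h1 := (p.hasDerivAt (Complex.tanh ((A * (x - x₀) : ℝ) : ℂ))).comp x
      (hasDerivAt_tanh_comp A x₀ x)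
    refine (((hasDerivAt_soliton A V φ₀ x₀ x).mul h1).deriv).trans ?_
    simp only [Function.comp, Polynomial.eval_add, Polynomial.eval_mul, Polynomial.eval_sub,
      Polynomial.eval_C, Polynomial.eval_X, Polynomial.eval_one, Polynomial.eval_pow]
    ring

lemma contDiff_soliton (A V φ₀ x₀ : ℝ) (n : ℕ∞) : ContDiff ℝ n (soliton A V φ₀ x₀) := by
  refine contDiff_of_differentiable_iteratedDeriv fun m _ => ?_
  obtain ⟨p, hp⟩ := iteratedDeriv_soliton A V φ₀ x₀ m
  rw [hp]
  intro x
  exact ((hasDerivAt_soliton A V φ₀ x₀ x).mul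
    ((p.hasDerivAt (Complex.tanh ((A * (x - x₀) : ℝ) : ℂ))).comp x
      (hasDerivAt_tanh_comp A x₀ x))).differentiableAt

lemma norm_tanh_ofReal_le_one (y : ℝ) : ‖Complex.tanh y‖ ≤ 1 := by
  rw [← ofReal_tanh, norm_real, Real.norm_eq_abs, abs_le]
  exact ⟨(Real.neg_one_lt_tanh y).le, (Real.tanh_lt_one y).le⟩

/-- `(A|x|)^m ≤ m! e^{A|x|}` and `A|x| ≤ A|x₀| + |A(x - x₀)|`, so the growth is absorbed by `sech t
≤ 2e^{-|t|}`. -/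
lemma pow_mul_norm_soliton_le {A : ℝ} (hA : 0 < A) (V φ₀ x₀ : ℝ) (m : ℕ) (x : ℝ) :
    |x| ^ m * ‖soliton A V φ₀ x₀ x‖ ≤
      m.factorial / A ^ m * Real.exp (A * |x₀|) * (2 * A) := by
  have h1 : ‖soliton A V φ₀ x₀ x‖ ≤ 2 * A * Real.exp (-|A * (x - x₀)|) := by
    have h2 : (Complex.cosh ((A * (x - x₀) : ℝ) : ℂ)) =
        Complex.cosh ((|A * (x - x₀)| : ℝ) : ℂ) := by
      rw [← ofReal_cosh, ← ofReal_cosh, Real.cosh_abs]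
    rw [soliton_eq, h2, div_eq_mul_inv, norm_mul, norm_mul, norm_phase, norm_real,
      Real.norm_of_nonneg hA.le, mul_one]
    refine (mul_le_mul_of_nonneg_left (norm_inv_cosh_le _) hA.le).trans_eq ?_
    ring
  have h2 : |x| ^ m ≤ m.factorial / A ^ m * (Real.exp (A * |x₀|) * Real.exp |A * (x - x₀)|) := by
    have h3 := Real.pow_div_factorial_le_exp (A * |x|) (by positivity) m
    have h4 : A * |x| ≤ A * |x₀| + |A * (x - x₀)| := by
      rw [abs_mul, abs_of_pos hA, ← mul_add]
      refine mul_le_mul_of_nonneg_left ?_ hA.le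
      simpa using abs_add_le x₀ (x - x₀)
    have h5 := h3.trans (Real.exp_le_exp.2 h4)
    rw [Real.exp_add, div_le_iff₀ (by positivity), mul_pow] at h5
    rw [div_mul_eq_mul_div, le_div_iff₀ (by positivity)]
    linarith
  have h3 : Real.exp |A * (x - x₀)| * Real.exp (-|A * (x - x₀)|) = 1 := by
    rw [← Real.exp_add]; simp
  calc |x| ^ m * ‖soliton A V φ₀ x₀ x‖
      ≤ m.factorial / A ^ m * (Real.exp (A * |x₀|) * Real.exp |A * (x - x₀)|) *
        (2 * A * Real.exp (-|A * (x - x₀)|)) := by gcongr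
    _ = _ := by
      linear_combination (m.factorial / A ^ m * Real.exp (A * |x₀|) * (2 * A)) * h3

lemma exists_schwartzMap_eq_soliton {A : ℝ} (hA : 0 < A) (V φ₀ x₀ : ℝ) :
    ∃ f : 𝓢(ℝ, ℂ), ∀ x, f x = soliton A V φ₀ x₀ x := by
  refine ⟨⟨soliton A V φ₀ x₀, contDiff_soliton A V φ₀ x₀ ⊤, fun m n => ?_⟩, fun x => rfl⟩
  obtain ⟨p, hp⟩ := iteratedDeriv_soliton A V φ₀ x₀ n
  obtain ⟨K, hK⟩ := (isCompact_closedBall (0 : ℂ) 1).exists_bound_of_continuousOn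
    (f := fun z => p.eval z) p.continuous.continuousOn
  refine ⟨m.factorial / A ^ m * Real.exp (A * |x₀|) * (2 * A) * K, fun x => ?_⟩
  rw [norm_iteratedFDeriv_eq_norm_iteratedDeriv, hp, norm_mul, ← mul_assoc, Real.norm_eq_abs]
  exact mul_le_mul (pow_mul_norm_soliton_le hA V φ₀ x₀ m x)
    (hK _ (by simpa using norm_tanh_ofReal_le_one (A * (x - x₀)))) (norm_nonneg _) (by positivity)

/-! ### Explicit forms and the reflectionless couplings -/

lemma transmission_eq (A V : ℝ) (c k : ℂ) :
    transmission c ((k + V / 2) / A) =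
      Gamma (1 / 2 - I * (k + V / 2) / A) ^ 2 /
        (Gamma (1 / 2 - I * c - I * (k + V / 2) / A) *
          Gamma (1 / 2 + I * c - I * (k + V / 2) / A)) := by
  rw [transmission, mul_div_assoc]

lemma neg_exp_mul_reflection_eq (A V φ₀ x₀ : ℝ) (c k : ℂ) :
    -(Complex.exp (I * (φ₀ + (2 * k + V) * x₀)) * reflection c ((k + V / 2) / A)) =
      -(Complex.sin (I * Real.pi * c) / I) * Complex.exp (I * (φ₀ + (2 * k + V) * x₀)) /
        Complex.cosh (Real.pi * (k + V / 2) / A) := by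
  rw [reflection, mul_div_assoc (Real.pi : ℂ)]
  ring

lemma reflection_I_mul_natCast (n : ℕ) (κ : ℂ) : reflection (I * n) κ = 0 := by
  have h : I * Real.pi * (I * n) = -(n * Real.pi) := by
    linear_combination (Real.pi * n : ℂ) * I_sq
  rw [reflection, h, Complex.sin_neg, Complex.sin_nat_mul_pi]
  simp

/-- Induction by the functional equation at `d + n` and `d - n - 1`. For the second it is applied to
`1/Γ`, where it also holds at the poles; these occur precisely when `a` vanishes. -/
lemma transmission_I_mul_natCast {κ : ℂ} (hκ : 0 ≤ κ.im) (n : ℕ) :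
    transmission (I * n) κ =
      ∏ j ∈ Finset.Icc 1 n, (1 / 2 - I * κ - j) / (1 / 2 - I * κ + j - 1) := by
  have hd : 0 < (1 / 2 - I * κ).re := by
    simp; linarith
  have e : ∀ m : ℕ, transmission (I * m) κ = Gamma (1 / 2 - I * κ) ^ 2 *
      ((Gamma (1 / 2 - I * κ + m))⁻¹ * (Gamma (1 / 2 - I * κ - m))⁻¹) := fun m => by
    have h1 : 1 / 2 - I * (I * m) - I * κ = 1 / 2 - I * κ + m := by
      linear_combination (-m : ℂ) * I_sq
    have h2 : 1 / 2 + I * (I * m) - I * κ = 1 / 2 - I * κ - m := by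
      linear_combination (m : ℂ) * I_sq
    rw [transmission, h1, h2, div_eq_mul_inv, mul_inv]
  rw [e]
  generalize 1 / 2 - I * κ = d at *
  induction n with
  | zero =>
    have : Gamma d ≠ 0 := Gamma_ne_zero_of_re_pos hd
    simp
    field_simp
  | succ n ih =>
    rw [Finset.prod_Icc_succ_top (by omega), ← ih]
    have h1 := add_natCast_ne_zero hd n
    have h2 : Gamma (d + (n + 1 : ℕ)) = (d + n) * Gamma (d + n) := by
      rw [← Gamma_add_one _ h1]
      push_cast
      congr 1
      ring
    have h3 : (Gamma (d - (n + 1 : ℕ)))⁻¹ = (d - (n + 1 : ℕ)) * (Gamma (d - n))⁻¹ := by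
      rw [one_div_Gamma_eq_self_mul_one_div_Gamma_add_one]
      congr 3
      push_cast
      ring
    have h4 : d + ((n + 1 : ℕ) : ℂ) - 1 = d + n := by push_cast; ring
    rw [h2, h3, h4, mul_inv]
    field_simp

section Zeros

variable {A : ℝ} {V : ℝ} {κ : ℕ → ℂ}

lemma im_of_eq (hκ : ∀ j, κ j = -V / 2 + (2 * j - 1) * I * A / 2) (j : ℕ) :
    (κ j).im = (2 * j - 1) * A / 2 := by
  have h : κ j = ((-V / 2 : ℝ) : ℂ) + (((2 * j - 1) * A / 2 : ℝ) : ℂ) * I := by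
    rw [hκ]; push_cast; ring
  rw [h]
  simp only [add_im, ofReal_im, im_ofReal_mul, I_im, mul_one, zero_add]

lemma sub_conj_ne_zero (hA : 0 < A) (hκ : ∀ j, κ j = -V / 2 + (2 * j - 1) * I * A / 2) {k : ℂ}
    (hk : 0 ≤ k.im) {j : ℕ} (hj : 1 ≤ j) : k - conj (κ j) ≠ 0 := by
  intro h
  have h1 := congrArg Complex.im h
  rw [sub_im, conj_im, im_of_eq hκ, zero_im] at h1
  have h2 : (1 : ℝ) ≤ j := by exact_mod_cast hj
  have : 0 < (2 * (j : ℝ) - 1) * A := mul_pos (by linarith) hA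
  linarith

lemma transmission_eq_prod (hA : 0 < A) (hκ : ∀ j, κ j = -V / 2 + (2 * j - 1) * I * A / 2)
    {k : ℂ} (hk : 0 ≤ k.im) (n : ℕ) :
    transmission (I * n) ((k + V / 2) / A) =
      ∏ j ∈ Finset.Icc 1 n, (k - κ j) / (k - conj (κ j)) := by
  have hA0 : (A : ℂ) ≠ 0 := by exact_mod_cast hA.ne'
  have him : 0 ≤ ((k + V / 2) / A).im := by
    rw [div_ofReal_im]
    have : ((V : ℂ) / 2).im = 0 := by simp
    rw [add_im, this, add_zero]
    positivity
  rw [transmission_I_mul_natCast him]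
  refine Finset.prod_congr rfl fun j _ => ?_
  have hconj : conj (κ j) = -V / 2 - (2 * j - 1) * I * A / 2 := by
    rw [hκ]
    simp [map_ofNat]
    ring
  -- Numerator and denominator share the factor `-i/A`, which cancels.
  have h1 : 1 / 2 - I * ((k + V / 2) / A) - j = -I / A * (k - κ j) := by
    rw [hκ]
    field_simp
    linear_combination ((1 - 2 * j) * A : ℂ) * I_sq
  have h2 : 1 / 2 - I * ((k + V / 2) / A) + j - 1 = -I / A * (k - conj (κ j)) := by
    rw [hconj]
    field_simp
    linear_combination ((2 * j - 1) * A : ℂ) * I_sq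
  have h3 : -I / A ≠ 0 := div_ne_zero (neg_ne_zero.2 I_ne_zero) hA0
  rw [h1, h2, mul_div_mul_left _ _ h3]

lemma prod_eq_zero_iff_mem (hA : 0 < A) (hκ : ∀ j, κ j = -V / 2 + (2 * j - 1) * I * A / 2) {k : ℂ}
    (hk : 0 ≤ k.im) (n : ℕ) :
    ∏ j ∈ Finset.Icc 1 n, (k - κ j) / (k - conj (κ j)) = 0 ↔ k ∈ κ '' Set.Icc 1 n := by
  rw [Finset.prod_eq_zero_iff]
  constructor
  · rintro ⟨j, hj, h⟩
    have hj' := Finset.mem_Icc.1 hj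
    rcases div_eq_zero_iff.1 h with h | h
    · exact ⟨j, hj', (sub_eq_zero.1 h).symm⟩
    · exact absurd h (sub_conj_ne_zero hA hκ hk hj'.1)
  · rintro ⟨j, hj, rfl⟩
    exact ⟨j, Finset.mem_Icc.2 hj, by simp⟩

lemma ncard_image_Icc (hA : 0 < A) (hκ : ∀ j, κ j = -V / 2 + (2 * j - 1) * I * A / 2) (n : ℕ) :
    (κ '' Set.Icc 1 n).ncard = n := by
  have hinj : Function.Injective κ := fun i j hij => by
    have h := congrArg Complex.im hij
    rw [im_of_eq hκ, im_of_eq hκ] at h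
    have h2 : ((i : ℝ) - j) * A = 0 := by linarith
    rcases mul_eq_zero.1 h2 with h3 | h3
    · exact_mod_cast sub_eq_zero.1 h3
    · exact absurd h3 hA.ne'
  rw [Set.ncard_image_of_injective _ hinj, ← Finset.coe_Icc, Set.ncard_coe_finset]
  simp

end Zeros

lemma sinh_pi_div_mul_eq {A : ℝ} (hA : 0 < A) (V : ℝ) (k : ℂ) :
    Complex.sinh (Real.pi / A * (k - (-V / 2 + I * A / 2))) =
      -I * Complex.cosh (Real.pi * ((k + V / 2) / A)) := by
  have hA0 : (A : ℂ) ≠ 0 := by exact_mod_cast hA.ne'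
  have h : (Real.pi : ℂ) / A * (k - (-V / 2 + I * A / 2)) =
      Real.pi * ((k + V / 2) / A) - Real.pi / 2 * I := by
    field_simp
    ring
  rw [h, Complex.sinh_sub, Complex.cosh_mul_I, Complex.sinh_mul_I, Complex.cos_pi_div_two,
    Complex.sin_pi_div_two]
  ring

end

end NLSQuench

/-! ### Assembly of the main theorem -/

theorem mainTheorem2 (A V φ₀ x₀ : ℝ) (hA : 0 < A) :
    -- the datum is rapidly decreasing
    (∃ f : 𝓢(ℝ, ℂ), ∀ x, f x = NLSQuench.soliton A V φ₀ x₀ x) ∧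
    -- the scattering data on the real line exist, are unique, and are given by the formulas
    (∀ (c : ℂ) (D : ℝ → ℂ × ℂ),
      NLSQuench.IsScatteringData c (NLSQuench.soliton A V φ₀ x₀) D ↔
        ∀ k : ℝ, D k =
          (Complex.Gamma (1 / 2 - I * (k + V / 2) / A) ^ 2 /
              (Complex.Gamma (1 / 2 - I * c - I * (k + V / 2) / A) *
                Complex.Gamma (1 / 2 + I * c - I * (k + V / 2) / A)),
            -(Complex.sin (I * Real.pi * c) / I) *
              Complex.exp (I * (φ₀ + (2 * k + V) * x₀)) /
                Complex.cosh (Real.pi * (k + V / 2) / A))) ∧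
    -- the coefficient `a` on the closed upper half-plane
    (∀ c k : ℂ, 0 ≤ k.im → ∀ a : ℂ,
      NLSQuench.IsUpperCoefficient c (NLSQuench.soliton A V φ₀ x₀) k a ↔
        a = Complex.Gamma (1 / 2 - I * (k + V / 2) / A) ^ 2 /
              (Complex.Gamma (1 / 2 - I * c - I * (k + V / 2) / A) *
                Complex.Gamma (1 / 2 + I * c - I * (k + V / 2) / A))) ∧
    -- the quench map from the coupling `i` at the one-soliton point
    (∀ c k₁ : ℂ, k₁ = -V / 2 + I * A / 2 →
      NLSQuench.IsScatteringData I (NLSQuench.soliton A V φ₀ x₀)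
        (fun k => ((k - k₁) / (k - conj k₁), 0)) ∧
      NLSQuench.QuenchMap c I
        (fun k => ((k - k₁) / (k - conj k₁), 0))
        (fun k =>
          (Complex.Gamma (1 - I / A * (k - k₁)) ^ 2 /
              (Complex.Gamma (1 - I * c - I / A * (k - k₁)) *
                Complex.Gamma (1 + I * c - I / A * (k - k₁))),
            Complex.sin (I * Real.pi * c) / I *
              Complex.exp (I * (φ₀ + (2 * k + V) * x₀)) *
                (I / Complex.sinh (Real.pi / A * (k - k₁)))))) ∧
    -- the couplings `c = i n`: reflectionless data, with exactly `n` simple zeros of `a`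
    (∀ (n : ℕ) (κ : ℕ → ℂ), (∀ j, κ j = -V / 2 + (2 * j - 1) * I * A / 2) →
      NLSQuench.IsScatteringData (I * n) (NLSQuench.soliton A V φ₀ x₀)
        (fun k => (∏ j ∈ Finset.Icc 1 n, (k - κ j) / (k - conj (κ j)), 0)) ∧
      (∀ k : ℂ, 0 ≤ k.im →
        NLSQuench.IsUpperCoefficient (I * n) (NLSQuench.soliton A V φ₀ x₀) k
          (∏ j ∈ Finset.Icc 1 n, (k - κ j) / (k - conj (κ j)))) ∧
      {k : ℂ | 0 ≤ k.im ∧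
          NLSQuench.IsUpperCoefficient (I * n) (NLSQuench.soliton A V φ₀ x₀) k 0} =
        κ '' Set.Icc 1 n ∧
      (κ '' Set.Icc 1 n).ncard = n) := by
  have hdata : ∀ (n : ℕ) (κ : ℕ → ℂ), (∀ j, κ j = -V / 2 + (2 * j - 1) * I * A / 2) →
      NLSQuench.IsScatteringData (I * n) (NLSQuench.soliton A V φ₀ x₀)
        (fun k => (∏ j ∈ Finset.Icc 1 n, (k - κ j) / (k - conj (κ j)), 0)) := by
    intro n κ hκ
    rw [NLSQuench.isScatteringData_soliton_iff hA]
    intro k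
    rw [NLSQuench.transmission_eq_prod hA hκ (by simp), NLSQuench.reflection_I_mul_natCast,
      mul_zero, neg_zero]
  obtain ⟨f, hf⟩ := NLSQuench.exists_schwartzMap_eq_soliton hA V φ₀ x₀
  refine ⟨⟨f, hf⟩, fun c D => ?_, fun c k hk a => ?_, fun c k₁ hk₁ => ?_, fun n κ hκ => ?_⟩
  · rw [NLSQuench.isScatteringData_soliton_iff hA]
    simp_rw [NLSQuench.transmission_eq, NLSQuench.neg_exp_mul_reflection_eq]
  · rw [NLSQuench.isUpperCoefficient_soliton_iff hA V φ₀ x₀ c hk, NLSQuench.transmission_eq]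
  · have h1 : NLSQuench.IsScatteringData I (NLSQuench.soliton A V φ₀ x₀)
        (fun k => ((k - k₁) / (k - conj k₁), 0)) := by
      -- The one-soliton data are the reflectionless case `n = 1`.
      have h := hdata 1 (fun j => -V / 2 + (2 * j - 1) * I * A / 2) fun _ => rfl
      have e : -V / 2 + (2 * ((1 : ℕ) : ℂ) - 1) * I * A / 2 = k₁ := by
        rw [hk₁]
        push_cast
        ring
      simp only [Finset.Icc_self, Finset.prod_singleton, e] at h
      simpa using h
    have hfs : (f : ℝ → ℂ) = NLSQuench.soliton A V φ₀ x₀ := funext hf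
    refine ⟨h1, f, hfs ▸ h1, ?_⟩
    rw [hfs, NLSQuench.isScatteringData_soliton_iff hA]
    intro k
    have hA0 : (A : ℂ) ≠ 0 := by exact_mod_cast hA.ne'
    have e : I / A * (k - k₁) = 1 / 2 + I * ((k + V / 2) / A) := by
      rw [hk₁]
      field_simp
      linear_combination (-A : ℂ) * I_sq
    refine Prod.ext ?_ ?_
    · rw [NLSQuench.transmission, e]
      ring_nf
    · have hI : ∀ z : ℂ, I / (-I * z) = -z⁻¹ := fun z => by
        rw [neg_mul, div_neg, div_mul_eq_div_div, div_self I_ne_zero, one_div]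
      simp only
      rw [hk₁, NLSQuench.sinh_pi_div_mul_eq hA, hI, NLSQuench.reflection]
      ring
  · refine ⟨hdata n κ hκ, fun k hk => ?_, ?_, NLSQuench.ncard_image_Icc hA hκ n⟩
    · rw [NLSQuench.isUpperCoefficient_soliton_iff hA V φ₀ x₀ _ hk,
        NLSQuench.transmission_eq_prod hA hκ hk]
    · ext k
      rw [Set.mem_ofPred_eq]
      constructor
      · rintro ⟨hk, h⟩
        rw [NLSQuench.isUpperCoefficient_soliton_iff hA V φ₀ x₀ _ hk,
          NLSQuench.transmission_eq_prod hA hκ hk] at h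
        exact (NLSQuench.prod_eq_zero_iff_mem hA hκ hk n).1 h.symm
      · intro h
        have hk : 0 ≤ k.im := by
          obtain ⟨j, hj, rfl⟩ := h
          have h2 : (1 : ℝ) ≤ j := by exact_mod_cast hj.1
          have : 0 < (2 * (j : ℝ) - 1) * A := mul_pos (by linarith) hA
          rw [NLSQuench.im_of_eq hκ]
          linarith
        refine ⟨hk, ?_⟩
        rw [NLSQuench.isUpperCoefficient_soliton_iff hA V φ₀ x₀ _ hk,
          NLSQuench.transmission_eq_prod hA hκ hk]
        exact ((NLSQuench.prod_eq_zero_iff_mem hA hκ hk n).2 h).symm
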